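/- A simple orthogonal polygon is a compact region $P\subset\mathbb{R}^2$ with nonempty interior whose boundary is a simple closed polygonal chain with axis-parallel edges. A sliding robot on an axis-parallel segment $s\subseteq P$, standing at $q\in s$, sees a point $p$ if the segment $\overline{pq}$ lies in $P$ and is perpendicular to $s$ (or $p=q$); the sliding visibility polygon of $s$ is the set of all points $p$ that are seen from some $q\in s$. Theorem. Let $P$ be a simple orthogonal polygon and let $S$ be a finite set of nondegenerate axis-parallel segments contained in $P$ whose sliding visibility polygons have union $P$. Let $c>0$. Then there are a time $T\ge 0$, a number $k\le|S|$, and sliding robots $r_1,\dots,r_k$, each moving during $[0,T]$ along its own segment $s_i\in S$ (distinct robots on distinct segments), where the motion of each robot consists of finitely many stages in each of which it either waits or moves in a straight line with constant speed $c$, such that every evader is detected: for every continuous $e:[0,T]\to P$ (an unpredictable evader, with no bound on its speed) there are $t\in[0,T]$ and $i$ such that $r_i$, at its position at time $t$, sees $e(t)$. The motions of the robots are fixed in advance and do not depend on $e$. -/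

import Mathlib

/-- The Euclidean plane. -/
abbrev Plane : Type := EuclideanSpace ℝ (Fin 2)

/-- `s` is a nondegenerate closed segment parallel to one of the coordinate axes. -/
def IsAxisSegment (s : Set Plane) : Prop :=
  ∃ a b : Plane, a ≠ b ∧ (a 0 = b 0 ∨ a 1 = b 1) ∧ s = segment ℝ a b

/-- The edge from the `i`-th vertex to the next one of a closed polygonal chain
with cyclically indexed vertices. -/
def chainEdge {n : ℕ} (v : ZMod n → Plane) (i : ZMod n) : Set Plane :=
  segment ℝ (v i) (v (i + 1))

/-- A simple closed orthogonal polygonal chain: the vertices are distinct, the edges are parallel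
to the axes, consecutive edges are perpendicular (each vertex is a genuine corner) and meet only
in their common vertex, and edges that are not consecutive are disjoint. -/
structure IsSimpleOrthogonalChain {n : ℕ} (v : ZMod n → Plane) : Prop where
  four_le : 4 ≤ n
  injective : Function.Injective v
  axis_parallel : ∀ i, v i 0 = v (i + 1) 0 ∨ v i 1 = v (i + 1) 1
  corner : ∀ i, inner ℝ (v (i + 1) - v i) (v (i + 1 + 1) - v (i + 1)) = 0
  consecutive : ∀ i, chainEdge v i ∩ chainEdge v (i + 1) = {v (i + 1)}
  disjoint : ∀ i j, i ≠ j → j ≠ i + 1 → i ≠ j + 1 → Disjoint (chainEdge v i) (chainEdge v j)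

/-- A simple orthogonal polygon: the compact region (with nonempty interior) whose boundary is a
simple closed orthogonal polygonal chain. -/
def IsSimpleOrthogonalPolygon (P : Set Plane) : Prop :=
  IsCompact P ∧ (interior P).Nonempty ∧
    ∃ (n : ℕ) (v : ZMod n → Plane), IsSimpleOrthogonalChain v ∧ frontier P = ⋃ i, chainEdge v i

/-- A sliding robot on the segment `s`, standing at `q ∈ s`, sees `p`: the segment from `p` to `q`
lies in `P` and is perpendicular to `s`. -/
def Sees (P s : Set Plane) (q p : Plane) : Prop :=
  q ∈ s ∧ segment ℝ p q ⊆ P ∧ ∀ x ∈ s, ∀ y ∈ s, inner ℝ (y - x) (p - q) = 0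

/-- The sliding visibility polygon of `s` in `P`. -/
def slidingVisibility (P s : Set Plane) : Set Plane :=
  {p | ∃ q, Sees P s q p}

/-- `γ` is, during the time interval `[0, T]`, a motion along `s` made of finitely many stages;
in each stage the robot waits, or moves in a straight line with constant speed `c`. -/
def IsSlidingMotion (c T : ℝ) (s : Set Plane) (γ : ℝ → Plane) : Prop :=
  (∀ t ∈ Set.Icc 0 T, γ t ∈ s) ∧
    ∃ (N : ℕ) (τ : ℕ → ℝ) (w : ℕ → Plane), τ 0 = 0 ∧ τ N = T ∧
      ∀ k < N, τ k ≤ τ (k + 1) ∧ (w k = 0 ∨ ‖w k‖ = c) ∧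
        ∀ t ∈ Set.Icc (τ k) (τ (k + 1)), γ t = γ (τ k) + (t - τ k) • w k

/-- A motion plan of finite duration for sliding robots of speed `c`, each moving along its own
segment of `S`. -/
structure MotionPlan (S : Finset (Set Plane)) (c : ℝ) where
  /-- the number of robots used -/
  robots : ℕ
  /-- the segment along which each robot moves -/
  track : Fin robots → Set Plane
  track_mem : ∀ i, track i ∈ S
  track_injective : Function.Injective track
  /-- the time at which the plan ends -/
  duration : ℝ
  duration_nonneg : 0 ≤ duration
  /-- the position of each robot at each time -/
  pos : Fin robots → ℝ → Plane
  motion : ∀ i, IsSlidingMotion c duration (track i) (pos i)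

/-- The plan clears `P`: every evader, moving continuously in `P` with no bound on its speed, is
seen by some robot at some time. The plan is fixed before the evader's trajectory is. -/
def MotionPlan.Clears {S : Finset (Set Plane)} {c : ℝ} (M : MotionPlan S c) (P : Set Plane) :
    Prop :=
  ∀ e : ℝ → Plane, ContinuousOn e (Set.Icc 0 M.duration) →
    (∀ t ∈ Set.Icc 0 M.duration, e t ∈ P) →
    ∃ t ∈ Set.Icc 0 M.duration, ∃ i, Sees P (M.track i) (M.pos i t) (e t)

/-!
The robots clear the polygon by induction on their number. One robot slides along its segment `s`
from end to end. The part of `P` that it does not see falls into pieces, each attached to the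
visible part along a single line of sight. Whenever the robot arrives at such a line it waits, and
the remaining robots, which together see all of every piece, clear the pieces attached there; its
line of sight meanwhile keeps the evader from entering or leaving these pieces. So an evader that
is never seen stays ahead of the sweeping robot for ever, which is impossible.

The recursion is not run on subpolygons but on arbitrary subsets `Q` of `P` covered by the
remaining robots (`exists_extension_clearing`). All the geometry it needs is a `SweepCoordinate`:
a continuous function on `P` that extends the projection of the visible part to `s` and has only
finitely many values on the invisible part. "Ahead of the robot" means that this coordinate exceeds
the position of the robot, and an evader can pass from ahead to behind only by taking the value
equal to the position, where it is seen or is inside a piece to be cleared.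

A sweep coordinate exists because lines of sight separate `P`. The chain bounding `P` is connected
and has two sides near each of its points, so its complement has at most two components; as `P` has
interior, `Pᶜ` is connected and `P` is the closure of its interior
(`IsSimpleOrthogonalPolygon.exists_isGridRegion`). Two points `α`, `β` outside `P`, just beyond the
ends of a chord of `P`, can therefore be joined outside `P`, and along such a path one constructs
a continuous real function on `P` measuring the angle subtended by `α` and `β`
(`Plane.exists_continuousOn_angle`). Its difference from the principal value of this angle is
locally constant off the chord and changes by `2π` across it (`IsGridRegion.exists_side`). Between
consecutive grid lines the visible part is a rectangle, and these jumps, interpolated linearly over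
the rectangles, add up to the sweep coordinate (`IsGridRegion.exists_isTruncatedSweep`).
-/

open Set Filter Topology

/-! ### Extending motions -/

/-- A motion can be prolonged by one stage of constant velocity. -/
theorem IsSlidingMotion.append {c T d : ℝ} {s : Set Plane} {γ : ℝ → Plane} {w : Plane}
    (h : IsSlidingMotion c T s γ) (hd : 0 ≤ d) (hw : w = 0 ∨ ‖w‖ = c)
    (hs : ∀ t ∈ Icc 0 d, γ T + t • w ∈ s) :
    IsSlidingMotion c (T + d) s (fun t => if t ≤ T then γ t else γ T + (t - T) • w) := by
  obtain ⟨hmem, N, τ, v, h0, hN, hst⟩ := h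
  have hle : ∀ k ≤ N, τ k ≤ T := by
    intro k hk
    induction hk using Nat.decreasingInduction with
    | self => exact hN.le
    | of_succ k hk ih => exact (hst k hk).1.trans ih
  refine ⟨fun t ht => ?_, N + 1, fun k => if k ≤ N then τ k else T + d,
    fun k => if k < N then v k else w, by simpa using h0, by simp, fun k hk => ?_⟩
  · dsimp only
    split_ifs with h1
    · exact hmem t ⟨ht.1, h1⟩
    · exact hs _ ⟨by linarith, by linarith [ht.2]⟩
  · rcases Nat.lt_succ_iff_lt_or_eq.1 hk with hk | rfl
    · have h1 := hst k hk
      have h2 := hle k hk.le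
      have h3 := hle (k + 1) hk
      simp only [hk, hk.le, Nat.succ_le_of_lt hk, if_true, h2]
      refine ⟨h1.1, h1.2.1, fun t ht => ?_⟩
      rw [if_pos (ht.2.trans h3)]
      exact h1.2.2 t ht
    · simp only [le_refl, lt_irrefl, if_true, if_false, Nat.not_succ_le_self, hN]
      refine ⟨by linarith, hw, fun t ht => ?_⟩
      split_ifs with h1
      · obtain rfl : t = T := le_antisymm h1 ht.1
        simp
      · rfl

variable {ι : Type*}

/-- The joint motion `γ₁` up to time `T₁` continues the joint motion `γ₀` up to time `T₀`, and the
robots outside `A` stand still in between. -/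
structure Extends (c : ℝ) (track : ι → Set Plane) (A : Finset ι) (T₀ : ℝ) (γ₀ : ι → ℝ → Plane)
    (T₁ : ℝ) (γ₁ : ι → ℝ → Plane) : Prop where
  le : T₀ ≤ T₁
  eq : ∀ i, ∀ t ≤ T₀, γ₁ i t = γ₀ i t
  wait : ∀ i ∉ A, ∀ t ∈ Icc T₀ T₁, γ₁ i t = γ₀ i T₀
  motion : ∀ i, IsSlidingMotion c T₁ (track i) (γ₁ i)

namespace Extends

variable {c T₀ T₁ T₂ : ℝ} {track : ι → Set Plane} {A B : Finset ι} {γ₀ γ₁ γ₂ : ι → ℝ → Plane}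

theorem refl (A : Finset ι) (h : ∀ i, IsSlidingMotion c T₀ (track i) (γ₀ i)) :
    Extends c track A T₀ γ₀ T₀ γ₀ :=
  ⟨le_rfl, fun _ _ _ => rfl, fun i _ t ht => by rw [le_antisymm ht.2 ht.1], h⟩

theorem mono (h : Extends c track A T₀ γ₀ T₁ γ₁) (hAB : A ⊆ B) :
    Extends c track B T₀ γ₀ T₁ γ₁ :=
  ⟨h.le, h.eq, fun i hi => h.wait i fun hA => hi (hAB hA), h.motion⟩

theorem trans (h : Extends c track A T₀ γ₀ T₁ γ₁) (h' : Extends c track A T₁ γ₁ T₂ γ₂) :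
    Extends c track A T₀ γ₀ T₂ γ₂ := by
  refine ⟨h.le.trans h'.le, fun i t ht => ?_, fun i hi t ht => ?_, h'.motion⟩
  · rw [h'.eq i t (ht.trans h.le), h.eq i t ht]
  · rcases le_total t T₁ with h1 | h1
    · rw [h'.eq i t h1, h.wait i hi t ⟨ht.1, h1⟩]
    · rw [h'.wait i hi t ⟨h1, ht.2⟩, h.wait i hi T₁ ⟨h.le, le_rfl⟩]

end Extends

/-- During `[T₀, T₁]` the evader `e` moves continuously in `Q` and no robot sees it. -/
structure Evades (P : Set Plane) (track : ι → Set Plane) (γ : ι → ℝ → Plane) (T₀ T₁ : ℝ)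
    (Q : Set Plane) (e : ℝ → Plane) : Prop where
  cont : ContinuousOn e (Icc T₀ T₁)
  mem : ∀ t ∈ Icc T₀ T₁, e t ∈ Q
  unseen : ∀ t ∈ Icc T₀ T₁, ∀ i, ¬ Sees P (track i) (γ i t) (e t)

theorem Evades.restrict {P Q : Set Plane} {track : ι → Set Plane} {γ γ' : ι → ℝ → Plane}
    {T₀ T₁ T₀' T₁' : ℝ} {e : ℝ → Plane} (h : Evades P track γ T₀ T₁ Q e) (h₀ : T₀ ≤ T₀')
    (h₁ : T₁' ≤ T₁) (hγ : ∀ i, ∀ t ∈ Icc T₀' T₁', γ i t = γ' i t) :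
    Evades P track γ' T₀' T₁' Q e := by
  have hsub : Icc T₀' T₁' ⊆ Icc T₀ T₁ := Icc_subset_Icc h₀ h₁
  exact ⟨h.cont.mono hsub, fun t ht => h.mem t (hsub ht),
    fun t ht i => by rw [← hγ i t ht]; exact h.unseen t (hsub ht) i⟩

/-! ### Sweep coordinates -/

/-- A unit-speed parametrization `x ↦ origin + x • dir`, `x ∈ [lo, hi]`, of the segment `s`,
together with a continuous `coord : P → [lo, hi]` that extends the map sending each point seen from
`s` to the parameter of the robot seeing it, and that takes only finitely many values on the
invisible part of `P`. When the robot stands at parameter `x`, its line of sight separates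
`{coord < x}` from `{coord > x}`. -/
structure SweepCoordinate (P s : Set Plane) where
  /-- the parameter at which the segment begins -/
  lo : ℝ
  /-- the parameter at which the segment ends -/
  hi : ℝ
  le : lo ≤ hi
  /-- the point with parameter zero -/
  origin : Plane
  /-- the unit direction of the segment -/
  dir : Plane
  norm_dir : ‖dir‖ = 1
  mem : ∀ x ∈ Icc lo hi, origin + x • dir ∈ s
  surj : ∀ q ∈ s, ∃ x ∈ Icc lo hi, origin + x • dir = q
  /-- the position of a robot on the segment that corresponds to a given point -/
  coord : Plane → ℝ
  continuousOn_coord : ContinuousOn coord P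
  coord_mem : ∀ p ∈ P, coord p ∈ Icc lo hi
  eq_of_sees : ∀ q p, Sees P s q p → q = origin + coord p • dir
  isClosed_visibility : IsClosed (slidingVisibility P s)
  finite_coord : (coord '' (P \ slidingVisibility P s)).Finite

namespace SweepCoordinate

variable {P : Set Plane}

theorem sees {s : Set Plane} (R : SweepCoordinate P s) {p : Plane}
    (hp : p ∈ slidingVisibility P s) : Sees P s (R.origin + R.coord p • R.dir) p := by
  obtain ⟨q, hq⟩ := hp
  rwa [← R.eq_of_sees q p hq]

variable {c T : ℝ} {track : ι → Set Plane} {γ : ι → ℝ → Plane}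

/-- A robot can be moved at speed `c` between any two points of its segment while the others
wait. -/
theorem exists_move [DecidableEq ι] {i : ι} (R : SweepCoordinate P (track i)) (hc : 0 < c)
    (hγ : ∀ j, IsSlidingMotion c T (track j) (γ j)) {x x' : ℝ} (hx : x ∈ Icc R.lo R.hi)
    (hx' : x' ∈ Icc R.lo R.hi) (hpos : γ i T = R.origin + x • R.dir) :
    ∃ T' γ', Extends c track {i} T γ T' γ' ∧ ∃ v : ℝ, x + (T' - T) * v = x' ∧ (x < x' → 0 < v) ∧
      ∀ t ∈ Icc T T', γ' i t = R.origin + (x + (t - T) * v) • R.dir := by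
  set d := |x' - x| / c with hd
  have hd0 : 0 ≤ d := by positivity
  set v := (x' - x) / d with hv
  have hdv : d * v = x' - x := by
    rcases eq_or_ne x x' with rfl | hne
    · simp [hv]
    · have : d ≠ 0 := by
        have : 0 < |x' - x| := abs_pos.2 (sub_ne_zero.2 hne.symm)
        positivity
      rw [hv]; field_simp
  have hw : v • R.dir = 0 ∨ ‖v • R.dir‖ = c := by
    rcases eq_or_ne x x' with rfl | hne
    · left; simp [hv]
    · right
      have : 0 < |x' - x| := abs_pos.2 (sub_ne_zero.2 hne.symm)
      rw [norm_smul, R.norm_dir, hv, hd, Real.norm_eq_abs, abs_div, abs_div, abs_abs,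
        abs_of_pos hc]
      field_simp
  have hpt : ∀ t : ℝ, γ i T + t • (v • R.dir) = R.origin + (x + t * v) • R.dir := by
    intro t; rw [hpos, smul_smul, add_smul, add_assoc]
  have hseg : ∀ t ∈ Icc 0 d, x + t * v ∈ Icc R.lo R.hi := by
    intro t ht
    rcases le_total 0 v with h | h
    · have h1 := mul_nonneg ht.1 h
      have h2 := mul_le_mul_of_nonneg_right ht.2 h
      exact ⟨by linarith [hx.1], by linarith [hx'.2]⟩
    · have h1 := mul_nonneg ht.1 (neg_nonneg.2 h)
      have h2 := mul_le_mul_of_nonneg_right ht.2 (neg_nonneg.2 h)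
      exact ⟨by linarith [hx'.1], by linarith [hx.2]⟩
  refine ⟨T + d, fun j t => if t ≤ T then γ j t else
    γ j T + (t - T) • (if j = i then v • R.dir else 0), ⟨by linarith, ?_, ?_, ?_⟩, v, ?_, ?_, ?_⟩
  · intro j t ht; simp [ht]
  · intro j hj t ht
    have hj : j ≠ i := by simpa using hj
    split_ifs with h1
    · rw [le_antisymm h1 ht.1]
    · simp
  · intro j
    by_cases hj : j = i
    · subst hj
      simp only [if_true]
      exact (hγ j).append hd0 hw fun t ht => by rw [hpt]; exact R.mem _ (hseg t ht)
    · simp only [hj, if_false]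
      refine (hγ j).append hd0 (Or.inl rfl) fun t ht => ?_
      obtain ⟨h1, N, τ, w, h2, h3, h4⟩ := hγ j
      have : 0 ≤ T := by
        have : ∀ k ≤ N, 0 ≤ τ k := by
          intro k hk
          induction k with
          | zero => exact h2.ge
          | succ k ih => exact (ih (by omega)).trans (h4 k (by omega)).1
        rw [← h3]; exact this N le_rfl
      simpa using h1 T ⟨this, le_rfl⟩
  · rw [add_sub_cancel_left, hdv]; ring
  · intro hlt
    have : 0 < |x' - x| := abs_pos.2 (sub_ne_zero.2 hlt.ne')
    have : 0 < d := by positivity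
    exact div_pos (by linarith) this
  · intro t ht
    dsimp only
    rw [if_pos rfl]
    split_ifs with h1
    · rw [le_antisymm h1 ht.1, hpos]; simp
    · exact hpt _

/-- An unseen evader stays ahead of a robot that sweeps over an interval without critical
values. -/
theorem le_coord_of_sweep {i : ι} (R : SweepCoordinate P (track i)) {T' x x' v : ℝ} {e : ℝ → Plane}
    {Q : Set Plane} (hQ : Q ⊆ P) (hT : T ≤ T') (hv : 0 < v) (hx : x + (T' - T) * v = x')
    (hpos : ∀ t ∈ Icc T T', γ i t = R.origin + (x + (t - T) * v) • R.dir)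
    (hcrit : ∀ y ∈ R.coord '' (P \ slidingVisibility P (track i)), ¬ (x < y ∧ y < x'))
    (he : Evades P track γ T T' Q e) (hstart : x < R.coord (e T)) : x' ≤ R.coord (e T') := by
  by_contra! hlt
  have hcont : ContinuousOn (fun t => (x + (t - T) * v) - R.coord (e t)) (Icc T T') :=
    (by fun_prop : Continuous fun t : ℝ => x + (t - T) * v).continuousOn.sub
      (R.continuousOn_coord.comp he.cont fun t ht => hQ (he.mem t ht))
  obtain ⟨t, ht, h0⟩ := intermediate_value_Icc hT hcont
    (show (0 : ℝ) ∈ Icc _ _ from ⟨by simp; linarith, by simp only [hx]; linarith⟩)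
  have h0 : R.coord (e t) = x + (t - T) * v := by simp only at h0; linarith
  have ht1 : T < t := by
    refine lt_of_le_of_ne ht.1 ?_
    rintro rfl
    simp at h0; linarith
  have ht2 : t < T' := by
    refine lt_of_le_of_ne ht.2 ?_
    rintro rfl
    linarith
  by_cases hvis : e t ∈ slidingVisibility P (track i)
  · refine he.unseen t ht i ?_
    rw [hpos t ht, ← h0]
    exact R.sees hvis
  · refine hcrit _ ⟨e t, ⟨hQ (he.mem t ht), hvis⟩, rfl⟩ ?_
    rw [h0]
    have h1 := mul_pos (sub_pos.2 ht1) hv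
    have h2 := mul_lt_mul_of_pos_right (sub_lt_sub_right ht2 T) hv
    exact ⟨by linarith, by linarith⟩

/-- While the robot waits at parameter `x`, an unseen evader cannot change between `coord = x` and
`coord ≠ x`. -/
theorem coord_eq_of_wait {i : ι} (R : SweepCoordinate P (track i)) {T' x : ℝ} {e : ℝ → Plane}
    {Q : Set Plane} (hQ : Q ⊆ P)
    (hpos : ∀ t ∈ Icc T T', γ i t = R.origin + x • R.dir)
    (he : Evades P track γ T T' Q e) {t₀ : ℝ} (ht₀ : t₀ ∈ Icc T T') (hx : R.coord (e t₀) = x) :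
    ∀ t ∈ Icc T T', e t ∈ {p ∈ Q \ slidingVisibility P (track i) | R.coord p = x} := by
  have hc : ContinuousOn (fun t => R.coord (e t)) (Icc T T') :=
    R.continuousOn_coord.comp he.cont fun t ht => hQ (he.mem t ht)
  have hvis : ∀ t ∈ Icc T T', R.coord (e t) = x → e t ∉ slidingVisibility P (track i) := by
    intro t ht h hv
    refine he.unseen t ht i ?_
    rw [hpos t ht, ← h]
    exact R.sees hv
  set F := (R.coord '' (P \ slidingVisibility P (track i))) \ {x} with hF
  have hFc : IsClosed F := (R.finite_coord.subset sdiff_subset).isClosed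
  -- in the waiting interval, `coord = x` is both a closed and an open condition
  have key : ∀ t ∈ Icc T T', R.coord (e t) = x := by
    by_contra! hne
    obtain ⟨t₁, ht₁, hne⟩ := hne
    obtain ⟨u, hu, hu'⟩ := continuousOn_iff'.1 hc {x}ᶜ isOpen_compl_singleton
    obtain ⟨w, hw, hw'⟩ := continuousOn_iff'.1 hc Fᶜ hFc.isOpen_compl
    obtain ⟨w₂, hw₂, hw₂'⟩ := continuousOn_iff'.1 he.cont (slidingVisibility P (track i))ᶜ
      R.isClosed_visibility.isOpen_compl
    have hxF : ∀ t ∈ Icc T T', R.coord (e t) = x → t ∈ w ∩ w₂ := by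
      intro t ht h
      have h1 : t ∈ w ∩ Icc T T' := by
        rw [← hw']; exact ⟨by simp [hF, h], ht⟩
      have h2 : t ∈ w₂ ∩ Icc T T' := by
        rw [← hw₂']; exact ⟨hvis t ht h, ht⟩
      exact ⟨h1.1, h2.1⟩
    obtain ⟨t, ht, hta, htb⟩ := isPreconnected_Icc (a := T) (b := T') u (w ∩ w₂) hu (hw.inter hw₂)
      (fun t ht => by
        by_cases h : R.coord (e t) = x
        · exact Or.inr (hxF t ht h)
        · left
          have : t ∈ u ∩ Icc T T' := by rw [← hu']; exact ⟨h, ht⟩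
          exact this.1)
      ⟨t₁, ht₁, by
          have : t₁ ∈ u ∩ Icc T T' := by rw [← hu']; exact ⟨hne, ht₁⟩
          exact this.1⟩
      ⟨t₀, ht₀, hxF t₀ ht₀ hx⟩
    have h1 : t ∈ (fun t => R.coord (e t)) ⁻¹' {x}ᶜ ∩ Icc T T' := by rw [hu']; exact ⟨hta, ht⟩
    have h2 : t ∈ (fun t => R.coord (e t)) ⁻¹' Fᶜ ∩ Icc T T' := by rw [hw']; exact ⟨htb.1, ht⟩
    have h3 : t ∈ e ⁻¹' (slidingVisibility P (track i))ᶜ ∩ Icc T T' := by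
      rw [hw₂']; exact ⟨htb.2, ht⟩
    exact h2.1 ⟨⟨e t, ⟨hQ (he.mem t ht), h3.1⟩, rfl⟩, h1.1⟩
  exact fun t ht => ⟨⟨he.mem t ht, hvis t ht (key t ht)⟩, key t ht⟩

end SweepCoordinate

/-! ### The clearing strategy -/

/-- Whatever the robots have done before, those in `A` can go on so as to clear any part `Q` of `P`
that they cover, while the other robots stand still. -/
theorem exists_extension_clearing [DecidableEq ι] {P : Set Plane} {track : ι → Set Plane} {c : ℝ}
    (hc : 0 < c) (R : ∀ i, SweepCoordinate P (track i)) (A : Finset ι) :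
    ∀ Q ⊆ P, (∀ p ∈ Q, ∃ i ∈ A, p ∈ slidingVisibility P (track i)) →
      ∀ T₀ γ₀, 0 ≤ T₀ → (∀ i, IsSlidingMotion c T₀ (track i) (γ₀ i)) →
        ∃ T₁ γ₁, Extends c track A T₀ γ₀ T₁ γ₁ ∧ ∀ e, ¬ Evades P track γ₁ T₀ T₁ Q e := by
  -- the robot added last sweeps its segment, and stops at the critical values of its coordinate
  -- for the other robots to clear the invisible parts of `Q` that are attached there
  induction A using Finset.induction_on with
  | empty =>
    intro Q _ hcov T₀ γ₀ _ hγ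
    refine ⟨T₀, γ₀, Extends.refl _ hγ, fun e he => ?_⟩
    obtain ⟨i, hi, _⟩ := hcov _ (he.mem T₀ ⟨le_rfl, le_rfl⟩)
    simp at hi
  | insert s A hs ih =>
    intro Q hQ hcov T₀ γ₀ hT₀ hγ
    set S := R s with hS
    -- if the evader can only be at or ahead of a robot waiting at `x`, the others drive it ahead
    have clear : ∀ x T γ, Extends c track (insert s A) T₀ γ₀ T γ → γ s T = S.origin + x • S.dir →
        (∀ e, Evades P track γ T₀ T Q e → x ≤ S.coord (e T)) →
        ∃ T' γ', Extends c track (insert s A) T₀ γ₀ T' γ' ∧ γ' s T' = S.origin + x • S.dir ∧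
          ∀ e, Evades P track γ' T₀ T' Q e → x < S.coord (e T') := by
      intro x T γ hext hpos hinv
      obtain ⟨T', γ', hext', hcl⟩ := ih {p ∈ Q \ slidingVisibility P (track s) | S.coord p = x}
        (fun p hp => hQ hp.1.1) (fun p hp => by
          obtain ⟨i, hi, hv⟩ := hcov p hp.1.1
          rcases Finset.mem_insert.1 hi with rfl | hi
          · exact absurd hv hp.1.2
          · exact ⟨i, hi, hv⟩) T γ (hT₀.trans hext.le) hext.motion
      have hwait : ∀ t ∈ Icc T T', γ' s t = S.origin + x • S.dir := fun t ht => by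
        rw [hext'.wait s hs t ht, hpos]
      refine ⟨T', γ', hext.trans (hext'.mono (Finset.subset_insert _ _)),
        hwait T' ⟨hext'.le, le_rfl⟩, fun e he => ?_⟩
      have he₁ : Evades P track γ T₀ T Q e :=
        he.restrict le_rfl hext'.le fun i t ht => hext'.eq i t ht.2
      have he₂ : Evades P track γ' T T' Q e := he.restrict hext.le le_rfl fun _ _ _ => rfl
      have hne : ∀ t ∈ Icc T T', S.coord (e t) ≠ x := fun t ht h =>
        hcl e ⟨he₂.cont, S.coord_eq_of_wait hQ hwait he₂ ht h, he₂.unseen⟩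
      by_contra! hle
      obtain ⟨t, ht, h⟩ := intermediate_value_Icc' hext'.le
        (S.continuousOn_coord.comp he₂.cont fun t ht => hQ (he₂.mem t ht)) ⟨hle, hinv e he₁⟩
      exact hne t ht h
    have hcrit : ∃ F : Finset ℝ, ∀ y ∈ S.coord '' (P \ slidingVisibility P (track s)), y ∈ F :=
      ⟨S.finite_coord.toFinset, fun y hy => by simpa using hy⟩
    obtain ⟨F, hF⟩ := hcrit
    have sweep : ∀ n : ℕ, ∀ x ∈ Icc S.lo S.hi, (F.filter (· < x)).card = n →
        ∃ T' γ', Extends c track (insert s A) T₀ γ₀ T' γ' ∧ γ' s T' = S.origin + x • S.dir ∧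
          ∀ e, Evades P track γ' T₀ T' Q e → x < S.coord (e T') := by
      intro n
      induction n using Nat.strong_induction_on with
      | _ n ihn =>
        intro x hx hn
        -- it suffices to find an earlier parameter `y` already dealt with, with no critical value
        -- strictly between `y` and `x`
        have step : ∀ y ∈ Icc S.lo S.hi, y < x → (∀ z ∈ F, ¬ (y < z ∧ z < x)) →
            (∃ T' γ', Extends c track (insert s A) T₀ γ₀ T' γ' ∧
              γ' s T' = S.origin + y • S.dir ∧
              ∀ e, Evades P track γ' T₀ T' Q e → y < S.coord (e T')) →
            ∃ T' γ', Extends c track (insert s A) T₀ γ₀ T' γ' ∧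
              γ' s T' = S.origin + x • S.dir ∧
              ∀ e, Evades P track γ' T₀ T' Q e → x < S.coord (e T') := by
          rintro y hy hyx hgap ⟨T, γ, hext, hpos, hinv⟩
          obtain ⟨T', γ', hext', v, hv, hv0, hpos'⟩ := S.exists_move hc hext.motion hy hx hpos
          refine clear x T' γ' (hext.trans (hext'.mono (by simp))) ?_ fun e he => ?_
          · rw [hpos' T' ⟨hext'.le, le_rfl⟩, hv]
          · exact S.le_coord_of_sweep hQ hext'.le (hv0 hyx) hv hpos'
              (fun z hz => hgap z (hF z hz)) (he.restrict hext.le le_rfl fun _ _ _ => rfl)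
              (hinv e (he.restrict le_rfl hext'.le fun i t ht => hext'.eq i t ht.2))
        have start : ∃ T' γ', Extends c track (insert s A) T₀ γ₀ T' γ' ∧
            γ' s T' = S.origin + S.lo • S.dir ∧
            ∀ e, Evades P track γ' T₀ T' Q e → S.lo < S.coord (e T') := by
          obtain ⟨y, hy, hpos⟩ := S.surj _ ((hγ s).1 T₀ ⟨hT₀, le_rfl⟩)
          obtain ⟨T', γ', hext', v, hv, hv0, hpos'⟩ :=
            S.exists_move hc hγ hy ⟨le_rfl, S.le⟩ hpos.symm
          refine clear S.lo T' γ' (hext'.mono (by simp)) ?_ fun e he =>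
            (S.coord_mem _ (hQ (he.mem T' ⟨hext'.le, le_rfl⟩))).1
          rw [hpos' T' ⟨hext'.le, le_rfl⟩, hv]
        rcases eq_or_lt_of_le hx.1 with rfl | hlt
        · exact start
        by_cases hex : ((F.filter (· < x)).filter (S.lo < ·)).Nonempty
        · obtain ⟨y, hy, hmax⟩ := Finset.exists_max_image _ id hex
          simp only [Finset.mem_filter, id] at hy hmax
          refine step y ⟨hy.2.le, hy.1.2.le.trans hx.2⟩ hy.1.2 (fun z hz h => ?_) ?_
          · exact absurd (hmax z ⟨⟨hz, h.2⟩, hy.2.trans h.1⟩) (not_le.2 h.1)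
          · refine ihn _ ?_ y ⟨hy.2.le, hy.1.2.le.trans hx.2⟩ rfl
            rw [← hn]
            refine Finset.card_lt_card (Finset.ssubset_iff_of_subset ?_ |>.2 ⟨y, ?_, ?_⟩)
            · intro z hz
              simp only [Finset.mem_filter] at hz ⊢
              exact ⟨hz.1, hz.2.trans hy.1.2⟩
            · simp [hy.1]
            · simp
        · refine step S.lo ⟨le_rfl, S.le⟩ hlt (fun z hz h => ?_) start
          exact hex ⟨z, by simp [hz, h.1, h.2]⟩
    obtain ⟨T₁, γ₁, hext, -, hinv⟩ := sweep _ S.hi ⟨S.le, le_rfl⟩ rfl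
    refine ⟨T₁, γ₁, hext, fun e he => ?_⟩
    exact absurd (S.coord_mem _ (hQ (he.mem T₁ ⟨hext.le, le_rfl⟩))).2 (not_le.2 (hinv e he))

/-! ### Two-sided closed sets -/

theorem IsPreconnected.exists_mem_frontier {X : Type*} [TopologicalSpace X] {t P : Set X}
    (ht : IsPreconnected t) {x y : X} (hx : x ∈ t) (hxP : x ∈ P) (hy : y ∈ t) (hyP : y ∉ P) :
    ∃ z ∈ t, z ∈ frontier P := by
  by_contra! h
  have hint : ∀ z ∈ t, z ∈ P → z ∈ interior P := fun z hz hzP => by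
    by_contra hzi
    exact h z hz ⟨subset_closure hzP, hzi⟩
  have hext : ∀ z ∈ t, z ∉ P → z ∈ (closure P)ᶜ := fun z hz hzP hzc =>
    h z hz ⟨hzc, fun hzi => hzP (interior_subset hzi)⟩
  obtain ⟨z, -, hz₁, hz₂⟩ := ht _ _ isOpen_interior isClosed_closure.isOpen_compl
    (fun z hz => (em (z ∈ P)).imp (hint z hz) (hext z hz)) ⟨x, hx, hint x hx hxP⟩
    ⟨y, hy, hext y hy hyP⟩
  exact hz₂ (subset_closure (interior_subset hz₁))

/-- `A₁` and `A₂` are the two local sides of `Γ` in the open set `B`. -/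
structure IsTwoSidedIn {X : Type*} [TopologicalSpace X] (Γ B A₁ A₂ : Set X) : Prop where
  isOpen : IsOpen B
  cover : B \ Γ ⊆ A₁ ∪ A₂
  preconnected₁ : IsPreconnected A₁
  preconnected₂ : IsPreconnected A₂
  disjoint₁ : Disjoint A₁ Γ
  disjoint₂ : Disjoint A₂ Γ
  closure₁ : B ∩ Γ ⊆ closure A₁
  closure₂ : B ∩ Γ ⊆ closure A₂

section TwoSided

variable {X : Type*} [TopologicalSpace X] {Γ B A₁ A₂ U V : Set X}

theorem IsTwoSidedIn.subset_or_subset (h : IsTwoSidedIn Γ B A₁ A₂) (hU : IsOpen U)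
    (hUΓ : Disjoint U Γ) (hU' : IsOpen (Γᶜ \ U)) {p : X} (hp : p ∈ B) (hpU : p ∈ closure U) :
    A₁ ⊆ U ∨ A₂ ⊆ U := by
  obtain ⟨q, hqB, hqU⟩ := mem_closure_iff.1 hpU B h.isOpen hp
  have key : ∀ A : Set X, IsPreconnected A → Disjoint A Γ → q ∈ A → A ⊆ U := fun A hA hAΓ hqA =>
    hA.subset_left_of_subset_union hU hU' disjoint_sdiff_right
      (fun z hz => (em (z ∈ U)).imp_right fun hzU => ⟨disjoint_left.1 hAΓ hz, hzU⟩) ⟨q, hqA, hqU⟩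
  exact (h.cover ⟨hqB, disjoint_left.1 hUΓ hqU⟩).imp (key _ h.preconnected₁ h.disjoint₁)
    (key _ h.preconnected₂ h.disjoint₂)

theorem IsClosed.compl_frontier_diff_interior {P : Set X} (hP : IsClosed P) :
    (frontier P)ᶜ \ interior P = Pᶜ := by
  ext z
  refine ⟨fun hz hzP => hz.1 ⟨subset_closure hzP, hz.2⟩,
    fun hz => ⟨fun h => hz (hP.frontier_subset h), fun h => hz (interior_subset h)⟩⟩

variable [PreconnectedSpace X]

/-- If `Γ` is connected and locally two-sided, then each open and closed part of its complement is
adjacent to every point of `Γ`. -/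
theorem subset_closure_of_isTwoSidedIn (hΓ : IsPreconnected Γ) (hne : Γ.Nonempty)
    (hloc : ∀ p ∈ Γ, ∃ B A₁ A₂, p ∈ B ∧ IsTwoSidedIn Γ B A₁ A₂) (hU : IsOpen U)
    (hUΓ : Disjoint U Γ) (hU' : IsOpen (Γᶜ \ U)) (hUne : U.Nonempty) : Γ ⊆ closure U := by
  have hfr : (frontier U).Nonempty := nonempty_frontier_iff.2
    ⟨hUne, fun h => hne.ne_empty (by simpa [h] using hUΓ)⟩
  obtain ⟨z, hzc, hzi⟩ := hfr
  rw [hU.interior_eq] at hzi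
  have hzΓ : z ∈ Γ := by
    by_contra hz
    obtain ⟨w, hw₁, hw₂⟩ := mem_closure_iff.1 hzc _ hU' ⟨hz, hzi⟩
    exact hw₁.2 hw₂
  intro p hp
  by_contra hpU
  -- the points of `Γ` adjacent to `U` form a relatively open set
  choose! B A₁ A₂ hB using hloc
  obtain ⟨w, hwΓ, hw₁, hw₂⟩ := hΓ (⋃ q ∈ Γ ∩ closure U, B q) (closure U)ᶜ
    (isOpen_biUnion fun q hq => (hB q hq.1).2.isOpen) isClosed_closure.isOpen_compl
    (fun q hq => (em (q ∈ closure U)).imp_left fun h =>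
      mem_iUnion₂.2 ⟨q, ⟨hq, h⟩, (hB q hq).1⟩)
    ⟨z, hzΓ, mem_iUnion₂.2 ⟨z, ⟨hzΓ, hzc⟩, (hB z hzΓ).1⟩⟩ ⟨p, hp, hpU⟩
  obtain ⟨q, hq, hwB⟩ := mem_iUnion₂.1 hw₁
  have h := (hB q hq.1).2
  refine hw₂ ?_
  rcases h.subset_or_subset hU hUΓ hU' (hB q hq.1).1 hq.2 with hA | hA
  · exact closure_mono hA (h.closure₁ ⟨hwB, hwΓ⟩)
  · exact closure_mono hA (h.closure₂ ⟨hwB, hwΓ⟩)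

/-- The complement of a connected, locally two-sided set has at most two components: if a
closed set `P` with nonempty interior has such a frontier, then its complement is connected. -/
theorem isPreconnected_compl_of_isTwoSidedIn {P : Set X} (hP : IsClosed P)
    (hint : (interior P).Nonempty) (hΓ : IsPreconnected (frontier P)) (hne : (frontier P).Nonempty)
    (hloc : ∀ p ∈ frontier P, ∃ B A₁ A₂, p ∈ B ∧ IsTwoSidedIn (frontier P) B A₁ A₂) :
    IsPreconnected Pᶜ := by
  intro u v hu hv huv ⟨x, hxP, hxu⟩ ⟨y, hyP, hyv⟩
  by_contra hemp
  have hfrP : frontier P ⊆ P := hP.frontier_subset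
  have hsplit : ∀ z, z ∉ frontier P → z ∈ P → z ∈ interior P := fun z hz hzP => by
    by_contra hzi
    exact hz ⟨subset_closure hzP, hzi⟩
  have hdisj : ∀ z, z ∉ P → z ∈ u → z ∉ v := fun z hz hzu hzv => hemp ⟨z, hz, hzu, hzv⟩
  have hI' : IsOpen ((frontier P)ᶜ \ interior P) := by
    rw [hP.compl_frontier_diff_interior]; exact hP.isOpen_compl
  have hI := subset_closure_of_isTwoSidedIn hΓ hne hloc isOpen_interior
    disjoint_interior_frontier hI' hint
  have hpart : ∀ a b : Set X, IsOpen a → IsOpen b → Pᶜ ⊆ a ∪ b → (∀ z, z ∉ P → z ∈ a → z ∉ b) →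
      IsOpen (Pᶜ ∩ a) ∧ Disjoint (Pᶜ ∩ a) (frontier P) ∧ IsOpen ((frontier P)ᶜ \ (Pᶜ ∩ a)) := by
    intro a b ha hb hab hd
    refine ⟨hP.isOpen_compl.inter ha, disjoint_left.2 fun z hz hz' => hz.1 (hfrP hz'), ?_⟩
    convert isOpen_interior (s := P).union (hP.isOpen_compl.inter hb) using 1
    ext z
    constructor
    · rintro ⟨hz, hza⟩
      by_cases hzP : z ∈ P
      · exact Or.inl (hsplit z hz hzP)
      · exact Or.inr ⟨hzP, (hab hzP).resolve_left fun h => hza ⟨hzP, h⟩⟩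
    · rintro (hz | ⟨hz, hzb⟩)
      · exact ⟨fun h => h.2 hz, fun h => h.1 (interior_subset hz)⟩
      · exact ⟨fun h => hz (hfrP h), fun h => hd z hz h.2 hzb⟩
  obtain ⟨hu₁, hu₂, hu₃⟩ := hpart u v hu hv huv hdisj
  obtain ⟨hv₁, hv₂, hv₃⟩ := hpart v u hv hu (by rwa [union_comm])
    fun z hz hzv hzu => hdisj z hz hzu hzv
  have hU := subset_closure_of_isTwoSidedIn hΓ hne hloc hu₁ hu₂ hu₃ ⟨x, hxP, hxu⟩
  have hV := subset_closure_of_isTwoSidedIn hΓ hne hloc hv₁ hv₂ hv₃ ⟨y, hyP, hyv⟩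
  obtain ⟨p, hp⟩ := hne
  obtain ⟨B, A₁, A₂, hpB, h⟩ := hloc p hp
  -- three disjoint sets cannot share the two sides of `frontier P` at `p`
  have hA : ∀ A : Set X, p ∈ closure A → A.Nonempty := fun A h => closure_nonempty_iff.1 ⟨p, h⟩
  obtain ⟨a₁, ha₁⟩ := hA A₁ (h.closure₁ ⟨hpB, hp⟩)
  obtain ⟨a₂, ha₂⟩ := hA A₂ (h.closure₂ ⟨hpB, hp⟩)
  have dI : ∀ z, z ∈ interior P → z ∈ Pᶜ → False := fun z h h' => h' (interior_subset h)
  rcases h.subset_or_subset isOpen_interior disjoint_interior_frontier hI' hpB (hI hp)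
    with h1 | h1 <;>
  rcases h.subset_or_subset hu₁ hu₂ hu₃ hpB (hU hp) with h2 | h2 <;>
  rcases h.subset_or_subset hv₁ hv₂ hv₃ hpB (hV hp) with h3 | h3
  · exact dI _ (h1 ha₁) (h2 ha₁).1
  · exact dI _ (h1 ha₁) (h2 ha₁).1
  · exact dI _ (h1 ha₁) (h3 ha₁).1
  · exact hdisj _ (h2 ha₂).1 (h2 ha₂).2 (h3 ha₂).2
  · exact hdisj _ (h2 ha₁).1 (h2 ha₁).2 (h3 ha₁).2
  · exact dI _ (h1 ha₂) (h3 ha₂).1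
  · exact dI _ (h1 ha₂) (h2 ha₂).1
  · exact dI _ (h1 ha₂) (h2 ha₂).1

/-- A connected, locally two-sided frontier leaves no room for lower-dimensional parts of `P`. -/
theorem subset_closure_interior_of_isTwoSidedIn {P : Set X} (hP : IsClosed P)
    (hint : (interior P).Nonempty) (hΓ : IsPreconnected (frontier P)) (hne : (frontier P).Nonempty)
    (hloc : ∀ p ∈ frontier P, ∃ B A₁ A₂, p ∈ B ∧ IsTwoSidedIn (frontier P) B A₁ A₂) :
    P ⊆ closure (interior P) := by
  have hI : frontier P ⊆ closure (interior P) :=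
    subset_closure_of_isTwoSidedIn hΓ hne hloc isOpen_interior disjoint_interior_frontier
      (by rw [hP.compl_frontier_diff_interior]; exact hP.isOpen_compl) hint
  intro z hz
  by_cases hzi : z ∈ interior P
  · exact subset_closure hzi
  · exact hI ⟨subset_closure hz, hzi⟩

end TwoSided

/-! ### Axis-parallel segments and boxes -/

namespace Plane

theorem eq_of_coord {i k : Fin 2} (hik : i ≠ k) {p q : Plane} (hi : p i = q i) (hk : p k = q k) :
    p = q := by
  ext m
  have : m = i ∨ m = k := by omega
  rcases this with rfl | rfl <;> assumption

theorem mem_segment_iff {i k : Fin 2} (hik : i ≠ k) {a b q : Plane} (h : a i = b i) :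
    q ∈ segment ℝ a b ↔ q i = a i ∧ q k ∈ uIcc (a k) (b k) := by
  rw [← segment_eq_uIcc, segment_eq_image', segment_eq_image']
  constructor
  · rintro ⟨θ, hθ, rfl⟩
    exact ⟨by simp [h], θ, hθ, by simp⟩
  · rintro ⟨hi, θ, hθ, hk⟩
    refine ⟨θ, hθ, eq_of_coord hik ?_ ?_⟩
    · simp [h, hi]
    · simpa using hk

theorem dist_le_add {i k : Fin 2} (hik : i ≠ k) (p q : Plane) :
    dist p q ≤ |p i - q i| + |p k - q k| := by
  have h : dist p q = √((p i - q i) ^ 2 + (p k - q k) ^ 2) := by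
    rw [EuclideanSpace.dist_eq, Fin.sum_univ_two, Real.dist_eq, Real.dist_eq, sq_abs, sq_abs]
    have : (i = 0 ∧ k = 1) ∨ (i = 1 ∧ k = 0) := by omega
    rcases this with ⟨rfl, rfl⟩ | ⟨rfl, rfl⟩
    · rfl
    · rw [add_comm]
  rw [h]
  rw [Real.sqrt_le_left (by positivity)]
  have := mul_nonneg (abs_nonneg (p i - q i)) (abs_nonneg (p k - q k))
  nlinarith [sq_abs (p i - q i), sq_abs (p k - q k)]

/-- The open square with centre `p` and side `2 * r`. -/
def box (p : Plane) (r : ℝ) : Set Plane := {q | |q 0 - p 0| < r ∧ |q 1 - p 1| < r}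

theorem mem_box {i k : Fin 2} (hik : i ≠ k) {p q : Plane} {r : ℝ} :
    q ∈ box p r ↔ |q i - p i| < r ∧ |q k - p k| < r := by
  have : (i = 0 ∧ k = 1) ∨ (i = 1 ∧ k = 0) := by omega
  rcases this with ⟨rfl, rfl⟩ | ⟨rfl, rfl⟩
  · rfl
  · exact and_comm

theorem isOpen_box (p : Plane) (r : ℝ) : IsOpen (box p r) :=
  (isOpen_lt (by fun_prop : Continuous fun q : Plane => |q 0 - p 0|) continuous_const).inter
    (isOpen_lt (by fun_prop : Continuous fun q : Plane => |q 1 - p 1|) continuous_const)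

theorem convex_coord_preimage (i : Fin 2) {s : Set ℝ} (hs : Convex ℝ s) :
    Convex ℝ {q : Plane | q i ∈ s} :=
  hs.linear_preimage (EuclideanSpace.proj (𝕜 := ℝ) i).toLinearMap

theorem convex_abs_lt (c r : ℝ) : Convex ℝ {x : ℝ | |x - c| < r} := by
  have : {x : ℝ | |x - c| < r} = Ioo (c - r) (c + r) := by
    ext x; simp only [mem_ofPred_eq, abs_lt, mem_Ioo]
    constructor <;> rintro ⟨h1, h2⟩ <;> constructor <;> linarith
  rw [this]; exact convex_Ioo _ _

theorem convex_box (p : Plane) (r : ℝ) : Convex ℝ (box p r) :=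
  (convex_coord_preimage 0 (convex_abs_lt _ _)).inter (convex_coord_preimage 1 (convex_abs_lt _ _))

theorem box_mono (p : Plane) {r r' : ℝ} (h : r ≤ r') : box p r ⊆ box p r' :=
  fun _ hq => ⟨hq.1.trans_le h, hq.2.trans_le h⟩

theorem mem_box_self (p : Plane) {r : ℝ} (hr : 0 < r) : p ∈ box p r := by simp [box, hr]

theorem exists_box_disjoint {C : Set Plane} (hC : IsClosed C) {p : Plane} (hp : p ∉ C) :
    ∃ r > 0, Disjoint (box p r) C := by
  obtain ⟨ε, hε, hsub⟩ := Metric.isOpen_iff.1 hC.isOpen_compl p hp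
  refine ⟨ε / 2, by positivity, disjoint_left.2 fun q hq hqC => hsub ?_ hqC⟩
  have := dist_le_add (i := 0) (k := 1) (by decide) q p
  rw [Metric.mem_ball]
  linarith [hq.1, hq.2]

theorem convex_mul_pos (i : Fin 2) (σ c : ℝ) : Convex ℝ {q : Plane | 0 < σ * (q i - c)} := by
  refine convex_coord_preimage i (s := {x | 0 < σ * (x - c)}) ?_
  intro x hx y hy a b ha hb hab
  simp only [mem_ofPred_eq, smul_eq_mul] at *
  have : σ * (a * x + b * y - c) = a * (σ * (x - c)) + b * (σ * (y - c)) := by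
    have : c = (a + b) * c := by rw [hab, one_mul]
    linear_combination σ * c * hab
  rw [this]
  rcases ha.lt_or_eq with h | rfl
  · have := mul_pos h hx
    have := mul_nonneg hb hy.le
    linarith
  · rw [zero_add] at hab
    subst hab; simpa using hy

/-- A point is in the closure of a set that contains the nearby points in some direction. -/
theorem mem_closure_of_forall_smul {A : Set Plane} {p d : Plane} {δ : ℝ} (hδ : 0 < δ)
    (h : ∀ ε, 0 < ε → ε < δ → p + ε • d ∈ A) : p ∈ closure A := by
  have ht : Tendsto (fun ε : ℝ => p + ε • d) (𝓝[>] 0) (𝓝 p) := by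
    have : Continuous fun ε : ℝ => p + ε • d := by fun_prop
    simpa using (this.tendsto 0).mono_left nhdsWithin_le_nhds
  refine mem_closure_of_tendsto ht ?_
  filter_upwards [Ioo_mem_nhdsGT hδ] with ε hε using h ε hε.1 hε.2

theorem exists_add_smul_mem {B : Set Plane} (hB : IsOpen B) {p : Plane} (hp : p ∈ B) (d : Plane) :
    ∃ δ > 0, ∀ ε : ℝ, 0 < ε → ε < δ → p + ε • d ∈ B := by
  have hc : Continuous fun ε : ℝ => p + ε • d := by fun_prop
  have : (fun ε : ℝ => p + ε • d) ⁻¹' B ∈ 𝓝 0 :=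
    (hB.preimage hc).mem_nhds (by simpa using hp)
  obtain ⟨δ, hδ, h⟩ := Metric.mem_nhds_iff.1 this
  exact ⟨δ, hδ, fun ε h0 h1 => h (by simpa [abs_of_pos h0] using h1)⟩

/-- A line has two sides: open half-planes. -/
theorem isTwoSidedIn_line {i : Fin 2} {Γ : Set Plane} {p : Plane} {r : ℝ}
    (hΓ : ∀ q ∈ box p r, q ∈ Γ ↔ q i = p i) :
    IsTwoSidedIn Γ (box p r) (box p r ∩ {q | 0 < 1 * (q i - p i)})
      (box p r ∩ {q | 0 < -1 * (q i - p i)}) where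
  isOpen := isOpen_box p r
  cover := by
    rintro q ⟨hq, hqΓ⟩
    rw [hΓ q hq] at hqΓ
    rcases lt_or_gt_of_ne hqΓ with h | h
    · exact Or.inr ⟨hq, by simp only [mem_ofPred_eq]; linarith⟩
    · exact Or.inl ⟨hq, by simp only [mem_ofPred_eq]; linarith⟩
  preconnected₁ := ((convex_box p r).inter (convex_mul_pos i _ _)).isPreconnected
  preconnected₂ := ((convex_box p r).inter (convex_mul_pos i _ _)).isPreconnected
  disjoint₁ := disjoint_left.2 fun q hq hqΓ => by
    have := (hΓ q hq.1).1 hqΓ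
    simpa [this] using hq.2
  disjoint₂ := disjoint_left.2 fun q hq hqΓ => by
    have := (hΓ q hq.1).1 hqΓ
    simpa [this] using hq.2
  closure₁ := by
    rintro q ⟨hq, hqΓ⟩
    rw [hΓ q hq] at hqΓ
    obtain ⟨δ, hδ, h⟩ := exists_add_smul_mem (isOpen_box p r) hq (EuclideanSpace.single i 1)
    exact mem_closure_of_forall_smul hδ fun ε h0 h1 => ⟨h ε h0 h1, by simp [hqΓ, h0]⟩
  closure₂ := by
    rintro q ⟨hq, hqΓ⟩
    rw [hΓ q hq] at hqΓ
    obtain ⟨δ, hδ, h⟩ := exists_add_smul_mem (isOpen_box p r) hq (EuclideanSpace.single i (-1))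
    exact mem_closure_of_forall_smul hδ fun ε h0 h1 => ⟨h ε h0 h1, by simp [hqΓ, h0]⟩

/-- A corner has two sides: an open quadrant and the complement of a closed quadrant. -/
theorem isTwoSidedIn_corner {i k : Fin 2} (hik : i ≠ k) {Γ : Set Plane} {p : Plane} {r σ τ : ℝ}
    (hσ : σ = 1 ∨ σ = -1) (hτ : τ = 1 ∨ τ = -1) (hr : 0 < r)
    (hΓ : ∀ q ∈ box p r, q ∈ Γ ↔
      (q i = p i ∧ 0 ≤ σ * (q k - p k)) ∨ (q k = p k ∧ 0 ≤ τ * (q i - p i))) :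
    IsTwoSidedIn Γ (box p r) (box p r ∩ ({q | 0 < σ * (q k - p k)} ∩ {q | 0 < τ * (q i - p i)}))
      (box p r ∩ {q | 0 < -σ * (q k - p k)} ∪ box p r ∩ {q | 0 < -τ * (q i - p i)}) := by
  have hσ2 : σ * σ = 1 := by rcases hσ with rfl | rfl <;> norm_num
  have hτ2 : τ * τ = 1 := by rcases hτ with rfl | rfl <;> norm_num
  -- the direction `d` points into the quadrant
  set d : Plane := EuclideanSpace.single k σ + EuclideanSpace.single i τ with hd
  have hdk : d k = σ := by simp [hd, hik.symm]
  have hdi : d i = τ := by simp [hd, hik]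
  refine ⟨isOpen_box p r, ?_, ?_, ?_, ?_, ?_, ?_, ?_⟩
  · rintro q ⟨hq, hqΓ⟩
    rw [hΓ q hq] at hqΓ
    push Not at hqΓ
    rcases lt_trichotomy 0 (σ * (q k - p k)) with h | h | h
    · rcases lt_trichotomy 0 (τ * (q i - p i)) with h' | h' | h'
      · exact Or.inl ⟨hq, h, h'⟩
      · have : q i = p i := by linear_combination (-τ) * h' - (q i - p i) * hτ2
        linarith [hqΓ.1 this]
      · exact Or.inr (Or.inr ⟨hq, by simp only [mem_ofPred_eq]; linarith⟩)
    · have : q k = p k := by linear_combination (-σ) * h - (q k - p k) * hσ2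
      exact Or.inr (Or.inr ⟨hq, by simp only [mem_ofPred_eq]; linarith [hqΓ.2 this]⟩)
    · exact Or.inr (Or.inl ⟨hq, by simp only [mem_ofPred_eq]; linarith⟩)
  · exact ((convex_box p r).inter ((convex_mul_pos k _ _).inter
      (convex_mul_pos i _ _))).isPreconnected
  · obtain ⟨δ, hδ, h⟩ := exists_add_smul_mem (isOpen_box p r) (mem_box_self p hr) (-d)
    have := h (δ / 2) (by positivity) (by linarith)
    refine IsPreconnected.union (p + (δ / 2) • -d) ⟨this, ?_⟩ ⟨this, ?_⟩
      ((convex_box p r).inter (convex_mul_pos k _ _)).isPreconnected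
      ((convex_box p r).inter (convex_mul_pos i _ _)).isPreconnected
    · have e : -σ * ((p + (δ / 2) • -d) k - p k) = δ / 2 := by
        simp [hdk]; linear_combination (δ / 2) * hσ2
      simp only [mem_ofPred_eq, e]; positivity
    · have e : -τ * ((p + (δ / 2) • -d) i - p i) = δ / 2 := by
        simp [hdi]; linear_combination (δ / 2) * hτ2
      simp only [mem_ofPred_eq, e]; positivity
  · refine disjoint_left.2 fun q hq hqΓ => ?_
    have h1 : 0 < σ * (q k - p k) := hq.2.1
    have h2 : 0 < τ * (q i - p i) := hq.2.2
    rcases (hΓ q hq.1).1 hqΓ with h | h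
    · simp [h.1] at h2
    · simp [h.1] at h1
  · refine disjoint_left.2 fun q hq hqΓ => ?_
    rcases hq with ⟨hq, h1⟩ | ⟨hq, h1⟩ <;> rcases (hΓ q hq).1 hqΓ with h | h <;>
      simp only [mem_ofPred_eq, neg_mul] at h1
    · linarith [h.2]
    · simp [h.1] at h1
    · simp [h.1] at h1
    · linarith [h.2]
  · rintro q ⟨hq, hqΓ⟩
    rw [hΓ q hq] at hqΓ
    obtain ⟨δ, hδ, h⟩ := exists_add_smul_mem (isOpen_box p r) hq d
    have hnn : 0 ≤ σ * (q k - p k) ∧ 0 ≤ τ * (q i - p i) := by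
      rcases hqΓ with h | h
      · exact ⟨h.2, by simp [h.1]⟩
      · exact ⟨by simp [h.1], h.2⟩
    refine mem_closure_of_forall_smul hδ fun ε h0 h1 => ⟨h ε h0 h1, ?_, ?_⟩
    · have e : σ * ((q + ε • d) k - p k) = σ * (q k - p k) + ε := by
        simp [hdk]; linear_combination ε * hσ2
      simp only [mem_ofPred_eq, e]; linarith
    · have e : τ * ((q + ε • d) i - p i) = τ * (q i - p i) + ε := by
        simp [hdi]; linear_combination ε * hτ2
      simp only [mem_ofPred_eq, e]; linarith
  · rintro q ⟨hq, hqΓ⟩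
    rw [hΓ q hq] at hqΓ
    obtain ⟨δ, hδ, h⟩ := exists_add_smul_mem (isOpen_box p r) hq (-d)
    refine mem_closure_of_forall_smul (d := -d) hδ fun ε h0 h1 => ?_
    rcases hqΓ with h' | h'
    · refine Or.inr ⟨h ε h0 h1, ?_⟩
      have e : -τ * ((q + ε • -d) i - p i) = ε := by
        simp [hdi, h'.1]; linear_combination ε * hτ2
      simpa only [mem_ofPred_eq, e] using h0
    · refine Or.inl ⟨h ε h0 h1, ?_⟩
      have e : -σ * ((q + ε • -d) k - p k) = ε := by
        simp [hdk, h'.1]; linear_combination ε * hσ2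
      simpa only [mem_ofPred_eq, e] using h0

/-- Near its endpoint `p`, an axis-parallel segment is a ray. -/
theorem exists_ray {i k : Fin 2} (hik : i ≠ k) {p u : Plane} (hu : u ≠ p) (h : p i = u i) :
    ∃ σ : ℝ, (σ = 1 ∨ σ = -1) ∧ 0 < |u k - p k| ∧ ∀ r ≤ |u k - p k|, ∀ q ∈ box p r,
      q ∈ segment ℝ p u ↔ q i = p i ∧ 0 ≤ σ * (q k - p k) := by
  have hk : u k ≠ p k := fun hk => hu (eq_of_coord hik h.symm hk)
  rcases lt_or_gt_of_ne hk with hlt | hlt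
  · refine ⟨-1, Or.inr rfl, abs_pos.2 (sub_ne_zero.2 hk), fun r hr q hq => ?_⟩
    rw [mem_segment_iff hik h, uIcc_of_ge hlt.le]
    rw [abs_of_neg (by linarith)] at hr
    have := abs_lt.1 ((mem_box hik).1 hq).2
    refine and_congr_right fun _ => ⟨fun h => by linarith [h.2],
      fun h => ⟨by linarith, by linarith⟩⟩
  · refine ⟨1, Or.inl rfl, abs_pos.2 (sub_ne_zero.2 hk), fun r hr q hq => ?_⟩
    rw [mem_segment_iff hik h, uIcc_of_le hlt.le]
    rw [abs_of_pos (by linarith)] at hr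
    have := abs_lt.1 ((mem_box hik).1 hq).2
    refine and_congr_right fun _ => ⟨fun h => by linarith [h.1],
      fun h => ⟨by linarith, by linarith⟩⟩

/-- Near a point other than its endpoints, an axis-parallel segment is a line. -/
theorem exists_line {i k : Fin 2} (hik : i ≠ k) {p a b : Plane} (h : a i = b i)
    (hp : p ∈ segment ℝ a b) (ha : p ≠ a) (hb : p ≠ b) :
    ∃ r₀ > 0, ∀ r ≤ r₀, ∀ q ∈ box p r, q ∈ segment ℝ a b ↔ q i = p i := by
  rw [mem_segment_iff hik h] at hp
  have hak : p k ≠ a k := fun hk => ha (eq_of_coord hik hp.1 hk)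
  have hbk : p k ≠ b k := fun hk => hb (eq_of_coord hik (hp.1.trans h) hk)
  refine ⟨min |p k - a k| |p k - b k|, lt_min (abs_pos.2 (sub_ne_zero.2 hak))
    (abs_pos.2 (sub_ne_zero.2 hbk)), fun r hr q hq => ?_⟩
  rw [mem_segment_iff hik h, hp.1]
  refine and_iff_left_of_imp fun _ => ?_
  have hq := abs_lt.1 ((mem_box hik).1 hq).2
  have h1 := hr.trans (min_le_left _ _)
  have h2 := hr.trans (min_le_right _ _)
  rcases mem_uIcc.1 hp.2 with h3 | h3
  · rw [abs_of_nonneg (by linarith)] at h1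
    rw [abs_of_nonpos (by linarith)] at h2
    exact mem_uIcc.2 (Or.inl ⟨by linarith, by linarith⟩)
  · rw [abs_of_nonpos (by linarith)] at h1
    rw [abs_of_nonneg (by linarith)] at h2
    exact mem_uIcc.2 (Or.inr ⟨by linarith, by linarith⟩)

end Plane

/-! ### Topology of simple orthogonal polygons -/

namespace IsSimpleOrthogonalChain

variable {n : ℕ} {v : ZMod n → Plane}

theorem isClosed_edge (v : ZMod n → Plane) (i : ZMod n) : IsClosed (chainEdge v i) := by
  rw [chainEdge, segment_eq_image']
  exact (isCompact_Icc.image (by fun_prop)).isClosed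

theorem ne_succ (h : IsSimpleOrthogonalChain v) (i : ZMod n) : v (i + 1) ≠ v i := by
  intro heq
  have h1 := h.injective heq
  have h4 := h.four_le
  have : Fact (1 < n) := ⟨by omega⟩
  simp at h1

/-- Only consecutive edges share points, namely their common vertex. -/
theorem eq_of_mem (h : IsSimpleOrthogonalChain v) {i j : ZMod n} {p : Plane}
    (hi : p ∈ chainEdge v i) (hj : p ∈ chainEdge v j) :
    j = i ∨ (j = i + 1 ∧ p = v (i + 1)) ∨ (i = j + 1 ∧ p = v i) := by
  by_contra! hne
  by_cases h1 : j = i + 1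
  · refine hne.2.1 h1 ?_
    subst h1
    have : p ∈ chainEdge v i ∩ chainEdge v (i + 1) := ⟨hi, hj⟩
    rwa [h.consecutive] at this
  by_cases h2 : i = j + 1
  · refine hne.2.2 h2 ?_
    subst h2
    have : p ∈ chainEdge v j ∩ chainEdge v (j + 1) := ⟨hj, hi⟩
    rwa [h.consecutive] at this
  exact disjoint_left.1 (h.disjoint i j (Ne.symm hne.1) h1 h2) hi hj

theorem isPreconnected_iUnion (h : IsSimpleOrthogonalChain v) :
    IsPreconnected (⋃ i, chainEdge v i) := by
  have : NeZero n := ⟨by have := h.four_le; omega⟩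
  refine IsPreconnected.iUnion_of_reflTransGen
    (fun i => (convex_segment _ _).isPreconnected) fun i j => ?_
  have key : ∀ m : ℕ, Relation.ReflTransGen
      (fun i j => (chainEdge v i ∩ chainEdge v j).Nonempty) i (i + m) := by
    intro m
    induction m with
    | zero => simpa using Relation.ReflTransGen.refl
    | succ m ih =>
      refine ih.tail ?_
      push_cast
      rw [← add_assoc, h.consecutive]
      exact singleton_nonempty _
  have := key (j - i).val
  rwa [ZMod.natCast_zmod_val, add_sub_cancel] at this

/-- A square around `p` that meets only those edges that contain `p`. -/
theorem exists_box (h : IsSimpleOrthogonalChain v) (p : Plane) :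
    ∃ r > 0, ∀ j, p ∉ chainEdge v j → Disjoint (Plane.box p r) (chainEdge v j) := by
  have : NeZero n := ⟨by have := h.four_le; omega⟩
  have hC : IsClosed (⋃ j ∈ {j | p ∉ chainEdge v j}, chainEdge v j) :=
    (toFinite _).isClosed_biUnion fun j _ => isClosed_edge v j
  obtain ⟨r, hr, hd⟩ := Plane.exists_box_disjoint hC (p := p) (by simp)
  exact ⟨r, hr, fun j hj => hd.mono_right (subset_biUnion_of_mem (u := chainEdge v) hj)⟩

theorem exists_isTwoSidedIn_vertex (h : IsSimpleOrthogonalChain v) (i : ZMod n) :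
    ∃ B A₁ A₂, v (i + 1) ∈ B ∧ IsTwoSidedIn (⋃ i, chainEdge v i) B A₁ A₂ := by
  set p := v (i + 1) with hp
  obtain ⟨r₀, hr₀, hdisj⟩ := h.exists_box p
  have hother : ∀ j, p ∈ chainEdge v j → j = i ∨ j = i + 1 := by
    intro j hj
    rcases h.eq_of_mem (right_mem_segment ℝ (v i) (v (i + 1))) hj with h1 | h1 | h1
    · exact Or.inl h1
    · exact Or.inr h1.1
    · exact absurd h1.2 (h.ne_succ i)
  have hne₁ : v i ≠ p := (h.ne_succ i).symm
  have hne₂ : v (i + 1 + 1) ≠ p := h.ne_succ (i + 1)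
  have hcorner := h.corner i
  rw [← hp] at hcorner
  simp only [PiLp.inner_apply, Fin.sum_univ_two, RCLike.inner_apply, conj_trivial,
    PiLp.sub_apply] at hcorner
  obtain ⟨k, m, hkm, hk, hm⟩ : ∃ k m : Fin 2, k ≠ m ∧ p k = v i k ∧ p m = v (i + 1 + 1) m := by
    rcases h.axis_parallel i with h0 | h0
    · refine ⟨0, 1, by decide, h0.symm, ?_⟩
      have h1 : v i 1 ≠ p 1 := fun h1 => hne₁ (Plane.eq_of_coord (by decide) h0 h1)
      rw [← hp] at h0
      rw [h0] at hcorner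
      have : (v (i + 1 + 1) 1 - p 1) * (p 1 - v i 1) = 0 := by linarith
      rcases mul_eq_zero.1 this with h2 | h2
      · linarith
      · exact absurd (by linarith) h1
    · refine ⟨1, 0, by decide, h0.symm, ?_⟩
      have h1 : v i 0 ≠ p 0 := fun h1 => hne₁ (Plane.eq_of_coord (by decide) h1 h0)
      rw [← hp] at h0
      rw [h0] at hcorner
      have : (v (i + 1 + 1) 0 - p 0) * (p 0 - v i 0) = 0 := by linarith
      rcases mul_eq_zero.1 this with h2 | h2
      · linarith
      · exact absurd (by linarith) h1
  obtain ⟨σ, hσ, hpos₁, hray₁⟩ := Plane.exists_ray hkm hne₁ hk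
  obtain ⟨τ, hτ, hpos₂, hray₂⟩ := Plane.exists_ray hkm.symm hne₂ hm
  set r := min r₀ (min |v i m - p m| |v (i + 1 + 1) k - p k|) with hr
  have hrpos : 0 < r := lt_min hr₀ (lt_min hpos₁ hpos₂)
  refine ⟨_, _, _, Plane.mem_box_self p hrpos,
    Plane.isTwoSidedIn_corner hkm hσ hτ hrpos fun q hq => ?_⟩
  rw [← hray₁ r ((min_le_right _ _).trans (min_le_left _ _)) q hq,
    ← hray₂ r ((min_le_right _ _).trans (min_le_right _ _)) q hq, segment_symm, mem_iUnion]
  constructor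
  · rintro ⟨j, hj⟩
    have hpj : p ∈ chainEdge v j := by
      by_contra hpj
      exact disjoint_left.1 (hdisj j hpj) (Plane.box_mono p (min_le_left _ _) hq) hj
    rcases hother j hpj with rfl | rfl
    · exact Or.inl hj
    · exact Or.inr hj
  · rintro (hj | hj)
    exacts [⟨i, hj⟩, ⟨i + 1, hj⟩]

theorem exists_isTwoSidedIn (h : IsSimpleOrthogonalChain v) {p : Plane}
    (hp : p ∈ ⋃ i, chainEdge v i) :
    ∃ B A₁ A₂, p ∈ B ∧ IsTwoSidedIn (⋃ i, chainEdge v i) B A₁ A₂ := by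
  by_cases hvert : ∃ i, p = v i
  · obtain ⟨i, rfl⟩ := hvert
    simpa using h.exists_isTwoSidedIn_vertex (i - 1)
  push Not at hvert
  obtain ⟨i, hi⟩ := mem_iUnion.1 hp
  obtain ⟨r₀, hr₀, hdisj⟩ := h.exists_box p
  obtain ⟨k, m, hkm, hk⟩ : ∃ k m : Fin 2, k ≠ m ∧ v i k = v (i + 1) k :=
    (h.axis_parallel i).elim (fun h0 => ⟨0, 1, by decide, h0⟩) fun h1 => ⟨1, 0, by decide, h1⟩
  obtain ⟨r₁, hr₁, hline⟩ := Plane.exists_line hkm hk hi (hvert i) (hvert (i + 1))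
  refine ⟨_, _, _, Plane.mem_box_self p (lt_min hr₀ hr₁),
    Plane.isTwoSidedIn_line (i := k) fun q hq => ?_⟩
  rw [← hline _ (min_le_right _ _) q hq, mem_iUnion]
  constructor
  · rintro ⟨j, hj⟩
    have hpj : p ∈ chainEdge v j := by
      by_contra hpj
      exact disjoint_left.1 (hdisj j hpj) (Plane.box_mono p (min_le_left _ _) hq) hj
    rcases h.eq_of_mem hi hpj with rfl | h1 | h1
    · exact hj
    · exact absurd h1.2 (hvert _)
    · exact absurd h1.2 (hvert _)
  · exact fun hj => ⟨i, hj⟩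

end IsSimpleOrthogonalChain

/-- A regular closed bounded set with connected complement whose boundary lies on the lines of the
grid given by a finite set `F` of coordinates. -/
structure IsGridRegion (P : Set Plane) (F : Finset ℝ) : Prop where
  isCompact : IsCompact P
  regular : P ⊆ closure (interior P)
  isPreconnected_compl : IsPreconnected Pᶜ
  frontier_subset : ∀ p ∈ frontier P, p 0 ∈ F ∨ p 1 ∈ F

theorem IsSimpleOrthogonalPolygon.exists_isGridRegion {P : Set Plane}
    (hP : IsSimpleOrthogonalPolygon P) : ∃ F, IsGridRegion P F := by
  obtain ⟨hc, hint, n, v, h, hfr⟩ := hP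
  have : NeZero n := ⟨by have := h.four_le; omega⟩
  have hpre : IsPreconnected (frontier P) := hfr ▸ h.isPreconnected_iUnion
  have hne : (frontier P).Nonempty := by
    rw [hfr]; exact ⟨v 0, mem_iUnion.2 ⟨0, left_mem_segment ℝ _ _⟩⟩
  have hloc : ∀ p ∈ frontier P, ∃ B A₁ A₂, p ∈ B ∧ IsTwoSidedIn (frontier P) B A₁ A₂ := by
    rw [hfr]; exact fun p hp => h.exists_isTwoSidedIn hp
  refine ⟨Finset.univ.image (fun i => v i 0) ∪ Finset.univ.image (fun i => v i 1), hc,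
    subset_closure_interior_of_isTwoSidedIn hc.isClosed hint hpre hne hloc,
    isPreconnected_compl_of_isTwoSidedIn hc.isClosed hint hpre hne hloc, fun p hp => ?_⟩
  rw [hfr] at hp
  obtain ⟨i, hi⟩ := mem_iUnion.1 hp
  rcases h.axis_parallel i with h0 | h0
  · left
    rw [((Plane.mem_segment_iff (k := 1) (by decide) h0).1 hi).1]
    simp
  · right
    rw [((Plane.mem_segment_iff (k := 0) (by decide) h0).1 hi).1]
    simp

/-! ### Angles seen from a point of a region with connected complement -/

theorem eq_of_forall_exists_int {X : Type*} [TopologicalSpace X] {s : Set X} (hs : IsPreconnected s)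
    {f : X → ℝ} (hf : ContinuousOn f s) (hint : ∀ p ∈ s, ∃ n : ℤ, f p = n) {x y : X} (hx : x ∈ s)
    (hy : y ∈ s) : f x = f y := by
  have hd : IsDiscrete (range ((↑) : ℤ → ℝ)) :=
    ⟨(Int.isClosedEmbedding_coe_real.isEmbedding.toHomeomorph.symm.isEmbedding).discreteTopology⟩
  exact hs.constant_of_mapsTo hd hf
    (fun p hp => by obtain ⟨n, hn⟩ := hint p hp; exact ⟨n, hn.symm⟩) hx hy

theorem finite_image_of_forall_exists_int {X : Type*} [TopologicalSpace X] {s : Set X}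
    (hs : IsCompact s) {f : X → ℝ} (hf : ContinuousOn f s) (hint : ∀ p ∈ s, ∃ n : ℤ, f p = n) :
    (f '' s).Finite := by
  have h := (Int.isClosedEmbedding_coe_real.isCompact_preimage (hs.image_of_continuousOn hf)).finite
    DiscreteTopology.isDiscrete
  refine (h.image ((↑) : ℤ → ℝ)).subset ?_
  rintro _ ⟨p, hp, rfl⟩
  obtain ⟨n, hn⟩ := hint p hp
  exact ⟨n, ⟨p, hp, hn⟩, hn.symm⟩

namespace Plane

/-- The complex number with real part `p i` and imaginary part `p k`. -/
noncomputable def toComplex (i k : Fin 2) (p : Plane) : ℂ := ⟨p i, p k⟩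

variable {i k : Fin 2}

theorem continuous_toComplex : Continuous (toComplex i k) := by
  have : toComplex i k = fun p => (p i : ℂ) + (p k : ℂ) * Complex.I := by
    ext p; exact Complex.mk_eq_add_mul_I _ _
  rw [this]; fun_prop

theorem toComplex_injective (hik : i ≠ k) : Function.Injective (toComplex i k) := by
  intro p q h
  exact eq_of_coord hik (congrArg Complex.re h) (congrArg Complex.im h)

/-- The argument of this quotient is the angle at `p` between the directions to `β` and `α`. -/
noncomputable def quot (i k : Fin 2) (α β p : Plane) : ℂ :=
  (toComplex i k p - toComplex i k α) / (toComplex i k p - toComplex i k β)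

theorem sub_ne_zero (hik : i ≠ k) {p q : Plane} (h : p ≠ q) :
    toComplex i k p - toComplex i k q ≠ 0 :=
  _root_.sub_ne_zero.2 ((toComplex_injective hik).ne h)

theorem quot_ne_zero (hik : i ≠ k) {α β p : Plane} (hα : p ≠ α) (hβ : p ≠ β) :
    quot i k α β p ≠ 0 := div_ne_zero (sub_ne_zero hik hα) (sub_ne_zero hik hβ)

theorem continuousAt_quot (hik : i ≠ k) {α β p : Plane} (hβ : p ≠ β) :
    ContinuousAt (quot i k α β) p :=
  (continuous_toComplex.sub continuous_const).continuousAt.div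
    (continuous_toComplex.sub continuous_const).continuousAt (sub_ne_zero hik hβ)

theorem quot_mem_slitPlane (hik : i ≠ k) {α β p : Plane} (hp : p ∉ segment ℝ α β) :
    quot i k α β p ∈ Complex.slitPlane := by
  have hβ : p ≠ β := fun h => hp (h ▸ right_mem_segment ℝ α β)
  by_contra hs
  rw [Complex.mem_slitPlane_iff] at hs
  push Not at hs
  obtain ⟨hre, him⟩ := hs
  set t := -(quot i k α β p).re with ht
  have h0 : 0 ≤ t := by linarith
  have hq : toComplex i k p - toComplex i k α = -(t : ℂ) * (toComplex i k p - toComplex i k β) := by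
    rw [← div_eq_iff (sub_ne_zero hik hβ)]
    apply Complex.ext
    · simp [ht, quot]
    · simpa [quot] using him
  have h1 : p i - α i = -t * (p i - β i) := by
    simpa [toComplex] using congrArg Complex.re hq
  have h2 : p k - α k = -t * (p k - β k) := by
    simpa [toComplex] using congrArg Complex.im hq
  have h3 : (1 + t) ≠ 0 := by positivity
  refine hp ⟨1 / (1 + t), t / (1 + t), by positivity, by positivity, by field_simp,
    eq_of_coord hik ?_ ?_⟩
  · simp only [PiLp.add_apply, PiLp.smul_apply, smul_eq_mul]
    field_simp; linarith
  · simp only [PiLp.add_apply, PiLp.smul_apply, smul_eq_mul]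
    field_simp; linarith

theorem continuousAt_arg_quot (hik : i ≠ k) {α β p : Plane} (hp : p ∉ segment ℝ α β) :
    ContinuousAt (fun p => (quot i k α β p).arg) p :=
  (Complex.continuousAt_arg (quot_mem_slitPlane hik hp)).comp
    (continuousAt_quot hik fun h => hp (h ▸ right_mem_segment ℝ α β))

/-- If the complement of `P` is connected, the angle between the directions to two points outside
`P` can be measured by a continuous real function on `P`: this is clear for two points joined by a
segment outside `P`, and angles add up along a chain of such points. -/
theorem exists_continuousOn_angle (hik : i ≠ k) {P : Set Plane} (hP : IsClosed P)
    (hconn : IsPreconnected Pᶜ) {α β : Plane} (hα : α ∉ P) (hβ : β ∉ P) :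
    ∃ h : Plane → ℝ, ContinuousOn h P ∧
      ∀ p ∈ P, (h p : Real.Angle) = ((quot i k α β p).arg : Real.Angle) := by
  refine hconn.induction₂ (fun α β => ∃ h : Plane → ℝ, ContinuousOn h P ∧
      ∀ p ∈ P, (h p : Real.Angle) = ((quot i k α β p).arg : Real.Angle)) ?_ ?_ ?_ hα hβ
  · intro x hx
    obtain ⟨ε, hε, hball⟩ := Metric.isOpen_iff.1 hP.isOpen_compl x hx
    filter_upwards [mem_nhdsWithin_of_mem_nhds (Metric.ball_mem_nhds x hε)] with y hy
    have hseg : segment ℝ x y ⊆ Pᶜ :=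
      ((convex_ball x ε).segment_subset (Metric.mem_ball_self hε) hy).trans hball
    exact ⟨fun p => (quot i k x y p).arg, fun p hp =>
      (continuousAt_arg_quot hik fun h => hseg h hp).continuousWithinAt, fun _ _ => rfl⟩
  · rintro x y z hx hy hz ⟨h₁, hc₁, h₁'⟩ ⟨h₂, hc₂, h₂'⟩
    refine ⟨fun p => h₁ p + h₂ p, hc₁.add hc₂, fun p hp => ?_⟩
    have hpx : p ≠ x := fun h => hx (h ▸ hp)
    have hpy : p ≠ y := fun h => hy (h ▸ hp)
    have hpz : p ≠ z := fun h => hz (h ▸ hp)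
    have hmul : quot i k x z p = quot i k x y p * quot i k y z p := by
      have := sub_ne_zero hik hpy
      have := sub_ne_zero hik hpz
      simp only [quot]; field_simp
    rw [Real.Angle.coe_add, h₁' p hp, h₂' p hp, hmul,
      Complex.arg_mul_coe_angle (quot_ne_zero hik hpx hpy) (quot_ne_zero hik hpy hpz)]
  · rintro x y hx hy ⟨h, hc, h'⟩
    refine ⟨fun p => -h p, hc.neg, fun p hp => ?_⟩
    have hinv : quot i k y x p = (quot i k x y p)⁻¹ := by simp only [quot, inv_div]
    rw [Real.Angle.coe_neg, h' p hp, hinv, Complex.arg_inv_coe_angle]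

/-- The point with `i`-th coordinate `x` and other coordinate `y`. -/
noncomputable def point (i : Fin 2) (x y : ℝ) : Plane :=
  WithLp.toLp 2 fun m => if m = i then x else y

@[simp] theorem point_same (i : Fin 2) (x y : ℝ) : point i x y i = x := by simp [point]

theorem point_other (hik : i ≠ k) (x y : ℝ) : point i x y k = y := by simp [point, hik.symm]

theorem point_eta (hik : i ≠ k) (p : Plane) : point i (p i) (p k) = p :=
  eq_of_coord hik (point_same _ _ _) (point_other hik _ _)

theorem point_of_eq (hik : i ≠ k) {p : Plane} {x y : ℝ} (hx : p i = x) (hy : p k = y) :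
    point i x y = p := by rw [← hx, ← hy, point_eta hik]

theorem continuous_point (hik : i ≠ k) : Continuous fun z : ℝ × ℝ => point i z.1 z.2 := by
  have : (fun z : ℝ × ℝ => point i z.1 z.2) =
      fun z => z.1 • EuclideanSpace.single i (1 : ℝ) + z.2 • EuclideanSpace.single k (1 : ℝ) := by
    ext1 z
    exact eq_of_coord hik (by simp [hik]) (by simp [point_other hik, hik.symm])
  rw [this]; fun_prop

theorem isPreconnected_prod (i k : Fin 2) {S T : Set ℝ} (hS : Convex ℝ S) (hT : Convex ℝ T) :
    IsPreconnected {p : Plane | p i ∈ S ∧ p k ∈ T} :=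
  ((convex_coord_preimage i hS).inter (convex_coord_preimage k hT)).isPreconnected

theorem isClosed_coord_preimage (i : Fin 2) {S : Set ℝ} (hS : IsClosed S) :
    IsClosed {p : Plane | p i ∈ S} := hS.preimage (by fun_prop : Continuous fun p : Plane => p i)

theorem isOpen_coord_preimage (i : Fin 2) {S : Set ℝ} (hS : IsOpen S) :
    IsOpen {p : Plane | p i ∈ S} := hS.preimage (by fun_prop : Continuous fun p : Plane => p i)

end Plane

/-! ### Strips of a grid region -/

/-- A closed set of reals with finite frontier contains, to the right of each of its points, an
interval that ends with a gap. -/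
theorem exists_right_gap {K G : Set ℝ} (hK : IsClosed K) (hb : BddAbove K) (h0 : 0 ∈ K)
    (hG : G.Finite) (hfr : frontier K ⊆ G) :
    ∃ l ≥ 0, Icc 0 l ⊆ K ∧ ∃ ε > 0, ∀ t ∈ Ioc l (l + ε), t ∉ K := by
  set S := {t | 0 ≤ t ∧ t ∉ K} with hS
  have hSb : BddBelow S := ⟨0, fun t ht => ht.1⟩
  have hSne : S.Nonempty := by
    obtain ⟨b, hb⟩ := hb
    exact ⟨b + 1, by linarith [hb h0], fun h => by linarith [hb h]⟩
  set l := sInf S with hl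
  have hl0 : 0 ≤ l := le_csInf hSne fun t ht => ht.1
  have hlt : ∀ t, 0 ≤ t → t < l → t ∈ K := fun t h h' => by
    by_contra ht
    exact (csInf_le hSb ⟨h, ht⟩).not_gt h'
  have hlK : l ∈ K := by
    rcases hl0.eq_or_lt with h | h
    · rwa [← h]
    · have : l ∈ closure (Ico 0 l) := by
        rw [closure_Ico h.ne]; exact ⟨hl0, le_rfl⟩
      exact hK.closure_subset_iff.2 (fun t ht => hlt t ht.1 ht.2) this
  refine ⟨l, hl0, fun t ht => ?_, ?_⟩
  · rcases ht.2.eq_or_lt with h | h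
    · rwa [h]
    · exact hlt t ht.1 h
  · obtain ⟨ε, hε, hball⟩ := Metric.isOpen_iff.1
      ((hG.subset (sdiff_subset (t := {l}))).isClosed.isOpen_compl) l (by simp)
    refine ⟨ε / 2, by positivity, fun t ht htK => ?_⟩
    obtain ⟨r, hr, hrt⟩ := exists_lt_of_csInf_lt hSne ht.1
    have hlr : l < r := lt_of_le_of_ne (csInf_le hSb hr) fun h => hr.2 (h ▸ hlK)
    obtain ⟨z, hz, hzf⟩ := (isPreconnected_Icc (a := r) (b := t)).exists_mem_frontier
      ⟨hrt.le, le_rfl⟩ htK ⟨le_rfl, hrt.le⟩ hr.2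
    refine hball (a := z) ?_ ⟨hfr hzf, (hlr.trans_le hz.1).ne'⟩
    rw [Metric.mem_ball, Real.dist_eq, abs_of_nonneg (by linarith [hz.1])]
    linarith [hz.2, ht.2]

namespace IsGridRegion

open Plane

variable {P : Set Plane} {F : Finset ℝ} {i k : Fin 2}

theorem frontier_subset' (hP : IsGridRegion P F) (hik : i ≠ k) {p : Plane} (hp : p ∈ frontier P) :
    p i ∈ F ∨ p k ∈ F := by
  have : (i = 0 ∧ k = 1) ∨ (i = 1 ∧ k = 0) := by omega
  rcases this with ⟨rfl, rfl⟩ | ⟨rfl, rfl⟩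
  · exact hP.frontier_subset p hp
  · exact (hP.frontier_subset p hp).symm

/-- Within a strip free of grid lines, a grid region is a product. -/
theorem point_mem_of_point_mem (hP : IsGridRegion P F) (hik : i ≠ k) {x₁ x₂ x x' y : ℝ}
    (hF : ∀ z ∈ F, z ∉ Ioo x₁ x₂) (hx : x ∈ Ioo x₁ x₂) (hx' : x' ∈ Ioo x₁ x₂)
    (h : point i x y ∈ P) : point i x' y ∈ P := by
  -- off the grid lines nothing of the frontier lies between the two points
  have key : ∀ p ∈ P, p i ∈ Ioo x₁ x₂ → p k ∉ F → point i x' (p k) ∈ P := by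
    intro p hp hpi hpk
    by_contra hn
    obtain ⟨z, hz, hzf⟩ := (isPreconnected_prod i k (convex_Ioo x₁ x₂)
      (convex_singleton (p k))).exists_mem_frontier (x := p) (y := point i x' (p k)) ⟨hpi, rfl⟩ hp
      ⟨by simpa using hx', by simp [point_other hik]⟩ hn
    rcases hP.frontier_subset' hik hzf with h | h
    · exact hF _ h hz.1
    · exact hpk (hz.2 ▸ h)
  have hdense : Dense {p : Plane | p k ∉ F} := by
    have h1 : Dense ((F : Set ℝ)ᶜ) := (Finset.finite_toSet F).countable.dense_compl ℝ
    let π : Plane →L[ℝ] ℝ := EuclideanSpace.proj k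
    exact h1.preimage (π.isOpenMap fun y => ⟨EuclideanSpace.single k y, by simp [π]⟩)
  have hopen : IsOpen (interior P ∩ {p : Plane | p i ∈ Ioo x₁ x₂}) :=
    isOpen_interior.inter (isOpen_coord_preimage i isOpen_Ioo)
  have hcl : point i x y ∈
      closure (interior P ∩ {p : Plane | p i ∈ Ioo x₁ x₂} ∩ {p | p k ∉ F}) := by
    refine closure_minimal (hdense.open_subset_closure_inter hopen) isClosed_closure ?_
    rw [inter_comm]
    exact (isOpen_coord_preimage i isOpen_Ioo).inter_closure ⟨by simpa using hx, hP.regular h⟩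
  have hf : Continuous fun p : Plane => point i x' (p k) :=
    (continuous_point hik).comp (by fun_prop : Continuous fun p : Plane => (x', p k))
  have := map_mem_closure hf hcl (t := P) fun p hp => key p (interior_subset hp.1.1) hp.1.2 hp.2
  rwa [hP.isCompact.isClosed.closure_eq, point_other hik] at this

theorem exists_gap (hP : IsGridRegion P F) (hik : i ≠ k) {x y₀ σ : ℝ} (hσ : σ = 1 ∨ σ = -1)
    (hx : x ∉ F) (h : point i x y₀ ∈ P) :
    ∃ l ≥ 0, (∀ t ∈ Icc 0 l, point i x (y₀ + σ * t) ∈ P) ∧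
      ∃ ε > 0, ∀ t ∈ Ioc l (l + ε), point i x (y₀ + σ * t) ∉ P := by
  have hσ0 : σ ≠ 0 := by rcases hσ with rfl | rfl <;> norm_num
  have hf : Continuous fun t : ℝ => point i x (y₀ + σ * t) :=
    (continuous_point hik).comp (by fun_prop : Continuous fun t : ℝ => (x, y₀ + σ * t))
  refine exists_right_gap (K := (fun t => point i x (y₀ + σ * t)) ⁻¹' P)
    (G := (fun t => y₀ + σ * t) ⁻¹' F) (hP.isCompact.isClosed.preimage hf) ?_ (by simpa using h)
    ((Finset.finite_toSet F).preimage ?_) ?_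
  · obtain ⟨C, hC⟩ := (hP.isCompact.image
      (by fun_prop : Continuous fun p : Plane => σ * (p k - y₀))).bddAbove
    refine ⟨C, fun t ht => ?_⟩
    have := hC ⟨_, ht, rfl⟩
    have hσ2 : σ * σ = 1 := by rcases hσ with rfl | rfl <;> norm_num
    simp only [point_other hik] at this
    linear_combination this - t * hσ2
  · intro t _ t' _ htt
    simpa [hσ0] using htt
  · intro t ht
    have := hf.frontier_preimage_subset P ht
    rcases hP.frontier_subset' hik this with h' | h'
    · simp only [point_same] at h'; exact absurd h' hx
    · simpa [point_other hik] using h'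

end IsGridRegion

namespace IsGridRegion

open Plane

variable {P : Set Plane} {F : Finset ℝ} {i k : Fin 2}

/-- A chord `{x₀} × [u, v]` crossing a rectangle in `P` separates the two sides of the rectangle:
there is a locally constant function on the rest of `P` that is `0` in the rectangle to
the left of the chord and `1` to the right of it. With `α` and `β` just beyond the ends of the
chord, it compares a continuous measure of the angle subtended by `α` and `β` with the principal
value, which jumps by `2π` across the chord. -/
theorem exists_side (hP : IsGridRegion P F) (hik : i ≠ k) {x₁ x₂ x₀ u v ε : ℝ} (hε : 0 < ε)
    (huv : u ≤ v)
    (hR : {p : Plane | p i ∈ Icc x₁ x₂ ∧ p k ∈ Icc u v} ⊆ P) (hx₀ : x₀ ∈ Icc x₁ x₂)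
    (hgap : ∀ y ∈ Icc (u - ε) (v + ε), point i x₀ y ∈ P → y ∈ Icc u v) :
    ∃ N : Plane → ℝ, ContinuousOn N (P \ {p | p i = x₀ ∧ p k ∈ Icc u v}) ∧
      (∀ p ∈ P, ∃ n : ℤ, N p = n) ∧
      ∀ p, p i ∈ Icc x₁ x₂ → p k ∈ Icc u v → (p i < x₀ → N p = 0) ∧ (x₀ < p i → N p = 1) := by
  have hπ := Real.pi_pos
  set R := {p : Plane | p i ∈ Icc x₁ x₂ ∧ p k ∈ Icc u v} with hRdef
  set α := point i x₀ (v + ε) with hα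
  set β := point i x₀ (u - ε) with hβ
  have hαP : α ∉ P := fun h => by
    have := (hgap (v + ε) ⟨by linarith, le_rfl⟩ h).2; linarith
  have hβP : β ∉ P := fun h => by
    have := (hgap (u - ε) ⟨le_rfl, by linarith⟩ h).1; linarith
  obtain ⟨h, hc, hang⟩ :=
    exists_continuousOn_angle hik hP.isCompact.isClosed hP.isPreconnected_compl hαP hβP
  set w := quot i k α β with hw
  have hw0 : ∀ p ∈ P, w p ≠ 0 := fun p hp =>
    quot_ne_zero hik (fun h => hαP (h ▸ hp)) fun h => hβP (h ▸ hp)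
  have hchord : ∀ p ∈ P, p ∈ segment ℝ α β → p i = x₀ ∧ p k ∈ Icc u v := by
    intro p hp hs
    rw [mem_segment_iff hik (by simp [hα, hβ])] at hs
    simp only [hα, hβ, point_same, point_other hik] at hs
    rw [uIcc_of_ge (by linarith)] at hs
    refine ⟨hs.1, hgap _ hs.2 ?_⟩
    rwa [point_of_eq hik hs.1 rfl]
  have hsub : ∀ p, toComplex i k p - toComplex i k α = ⟨p i - x₀, p k - (v + ε)⟩ ∧
      toComplex i k p - toComplex i k β = ⟨p i - x₀, p k - (u - ε)⟩ := fun p => by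
    constructor <;> apply Complex.ext <;> simp [toComplex, hα, hβ, point_other hik]
  -- the sign of the imaginary part of `w` tells the sides of the chord apart
  have him : ∀ p ∈ R, ∃ C > 0, (w p).im = -C * (p i - x₀) := by
    intro p hp
    have hpos : 0 < Complex.normSq (toComplex i k p - toComplex i k β) :=
      Complex.normSq_pos.2 (sub_ne_zero hik fun h => hβP (h ▸ hR hp))
    refine ⟨(v - u + 2 * ε) / Complex.normSq (toComplex i k p - toComplex i k β),
      div_pos (by linarith) hpos, ?_⟩
    rw [hw, quot, Complex.div_im, (hsub p).1]
    rw [(hsub p).2] at hpos ⊢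
    field_simp; ring
  have hslit : ∀ p ∈ R, -w p ∈ Complex.slitPlane := by
    intro p hp
    rw [Complex.mem_slitPlane_iff]
    by_cases h0 : p i = x₀
    · left
      have h1 : 0 < (v + ε - p k) := by linarith [hp.2.2]
      have h2 : 0 < (p k - (u - ε)) := by linarith [hp.2.1]
      have : -w p = (((v + ε - p k) / (p k - (u - ε)) : ℝ) : ℂ) := by
        have e1 : toComplex i k p - toComplex i k α = -((v + ε - p k : ℝ) : ℂ) * Complex.I := by
          rw [(hsub p).1]; apply Complex.ext <;> simp [h0]
        have e2 : toComplex i k p - toComplex i k β = ((p k - (u - ε) : ℝ) : ℂ) * Complex.I := by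
          rw [(hsub p).2]; apply Complex.ext <;> simp [h0]
        rw [hw, quot, e1, e2, mul_div_mul_right _ _ Complex.I_ne_zero, neg_div, neg_neg,
          Complex.ofReal_div]
      rw [this, Complex.ofReal_re]
      exact div_pos h1 h2
    · right
      obtain ⟨C, hC, e⟩ := him p hp
      rw [Complex.neg_im, e]
      simp [hC.ne', _root_.sub_ne_zero.2 h0]
  -- `m` measures the angle on the whole rectangle, relative to a branch continuous there
  set m : Plane → ℝ := fun p => (h p - (-w p).arg - Real.pi) / (2 * Real.pi) with hm
  have hmc : ContinuousOn m R := by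
    refine ((hc.mono hR).sub fun p hp => ?_).sub continuousOn_const |>.div_const _
    have h1 : ContinuousAt w p := continuousAt_quot hik fun h => hβP (h ▸ hR hp)
    exact ((Complex.continuousAt_arg (hslit p hp)).comp
      (f := fun p => -w p) h1.neg).continuousWithinAt
  have hmi : ∀ p ∈ R, ∃ n : ℤ, m p = n := by
    intro p hp
    have : (h p : Real.Angle) = (((-w p).arg + Real.pi : ℝ) : Real.Angle) := by
      rw [hang p (hR hp), Real.Angle.coe_add, Complex.arg_neg_coe_angle (hw0 p (hR hp)), add_assoc,
        ← Real.Angle.coe_add, ← two_mul, Real.Angle.coe_two_pi, add_zero]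
    obtain ⟨n, hn⟩ := Real.Angle.angle_eq_iff_two_pi_dvd_sub.1 this
    refine ⟨n, ?_⟩
    simp only [hm]
    field_simp
    linarith
  set q := point i x₀ u with hq
  have hqR : q ∈ R := ⟨by simpa [hq] using hx₀, by simp [hq, point_other hik, huv]⟩
  have hmconst : ∀ p ∈ R, m p = m q := fun p hp =>
    eq_of_forall_exists_int (isPreconnected_prod i k (convex_Icc _ _) (convex_Icc _ _)) hmc hmi
      hp hqR
  refine ⟨fun p => (h p - (w p).arg) / (2 * Real.pi) - m q, ?_, ?_, ?_⟩
  · refine ((hc.mono sdiff_subset).sub fun p hp => ?_).div_const _ |>.sub continuousOn_const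
    exact (continuousAt_arg_quot hik fun hs => hp.2 (hchord p hp.1 hs)).continuousWithinAt
  · intro p hp
    obtain ⟨n, hn⟩ := Real.Angle.angle_eq_iff_two_pi_dvd_sub.1 (hang p hp)
    obtain ⟨n', hn'⟩ := hmi q hqR
    refine ⟨n - n', ?_⟩
    dsimp only
    rw [hn, hn']; push_cast; field_simp
  · intro p hp₁ hp₂
    have hpR : p ∈ R := ⟨hp₁, hp₂⟩
    obtain ⟨C, hC, e⟩ := him p hpR
    rw [← hmconst p hpR]
    simp only [hm]
    constructor
    · intro hlt
      have : 0 < (w p).im := by rw [e]; nlinarith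
      rw [Complex.arg_neg_eq_arg_sub_pi_of_im_pos this]
      field_simp; ring
    · intro hlt
      have : (w p).im < 0 := by rw [e]; nlinarith
      rw [Complex.arg_neg_eq_arg_add_pi_of_im_neg this]
      field_simp; ring

/-- The points of `P` from which one can go within `P`, at right angles, to the segment
`[a, b] × {y₀}`. -/
def _root_.Plane.visible (P : Set Plane) (i k : Fin 2) (a b y₀ : ℝ) : Set Plane :=
  {p | p i ∈ Icc a b ∧ ∀ y ∈ uIcc (p k) y₀, point i (p i) y ∈ P}

theorem _root_.Plane.visible_subset (hik : i ≠ k) {a b y₀ : ℝ} : visible P i k a b y₀ ⊆ P := by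
  intro p hp
  have := hp.2 (p k) left_mem_uIcc
  rwa [point_eta hik] at this

theorem isClosed_visible (hP : IsGridRegion P F) (hik : i ≠ k) (a b y₀ : ℝ) :
    IsClosed (visible P i k a b y₀) := by
  have : visible P i k a b y₀ = {p | p i ∈ Icc a b} ∩
      ⋂ θ ∈ Icc (0 : ℝ) 1, (fun p : Plane => point i (p i) (p k + θ * (y₀ - p k))) ⁻¹' P := by
    ext p
    simp only [visible, ← segment_eq_uIcc, segment_eq_image', mem_ofPred_eq, mem_inter_iff,
      mem_iInter, mem_preimage, forall_mem_image, smul_eq_mul]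
  rw [this]
  refine (isClosed_coord_preimage i isClosed_Icc).inter (isClosed_biInter fun θ _ => ?_)
  refine hP.isCompact.isClosed.preimage ((continuous_point hik).comp
    (by fun_prop : Continuous fun p : Plane => (p i, p k + θ * (y₀ - p k))))

/-- `g` is a continuous extension to `P` of the projection of the points visible from
`[a, b] × {y₀}` to that segment, truncated to the subinterval `[x₁, x₂]`. -/
structure IsTruncatedSweep (P : Set Plane) (i k : Fin 2) (a b y₀ x₁ x₂ : ℝ) (g : Plane → ℝ) :
    Prop where
  continuousOn : ContinuousOn g P
  eq : ∀ p ∈ visible P i k a b y₀, g p = max x₁ (min x₂ (p i))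
  finite : (g '' (P \ visible P i k a b y₀)).Finite

/-- Over a strip free of grid lines the visible region is a rectangle `R`, whose horizontal sides
bound `P`. The coordinate is the abscissa on `R`; outside `R` it is `x₁` plus an integral multiple
of `x₂ - x₁`, which the side function of the chord in the middle of `R` provides. -/
theorem exists_isTruncatedSweep_of_strip (hP : IsGridRegion P F) (hik : i ≠ k) {a b y₀ : ℝ}
    (hs : ∀ x ∈ Icc a b, point i x y₀ ∈ P) {x₁ x₂ : ℝ} (hlt : x₁ < x₂) (ha : a ≤ x₁) (hb : x₂ ≤ b)
    (hF : ∀ z ∈ F, z ∉ Ioo x₁ x₂) : ∃ g, IsTruncatedSweep P i k a b y₀ x₁ x₂ g := by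
  set x₀ := (x₁ + x₂) / 2 with hx₀
  have hx₀m : x₀ ∈ Ioo x₁ x₂ := ⟨by rw [hx₀]; linarith, by rw [hx₀]; linarith⟩
  have hx₀F : x₀ ∉ F := fun h => hF _ h hx₀m
  have hx₀P : point i x₀ y₀ ∈ P := hs _ ⟨by linarith [hx₀m.1], by linarith [hx₀m.2]⟩
  obtain ⟨l₁, hl₁, hin₁, ε₁, hε₁, hout₁⟩ := hP.exists_gap hik (Or.inl rfl) hx₀F hx₀P
  obtain ⟨l₂, hl₂, hin₂, ε₂, hε₂, hout₂⟩ := hP.exists_gap hik (Or.inr rfl) hx₀F hx₀P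
  set v := y₀ + l₁ with hv
  set u := y₀ - l₂ with hu
  set ε := min ε₁ ε₂ with hε
  have hεpos : 0 < ε := lt_min hε₁ hε₂
  have hy₀ : y₀ ∈ Icc u v := ⟨by linarith, by linarith⟩
  have hprod : ∀ x ∈ Ioo x₁ x₂, ∀ y, point i x y ∈ P ↔ point i x₀ y ∈ P := fun x hx y =>
    ⟨hP.point_mem_of_point_mem hik hF hx hx₀m, hP.point_mem_of_point_mem hik hF hx₀m hx⟩
  have hin : ∀ y ∈ Icc u v, point i x₀ y ∈ P := by
    intro y hy
    rcases le_total y₀ y with h | h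
    · have := hin₁ (y - y₀) ⟨by linarith, by linarith [hy.2]⟩
      rwa [one_mul, add_sub_cancel] at this
    · have := hin₂ (y₀ - y) ⟨by linarith, by linarith [hy.1]⟩
      rwa [show y₀ + -1 * (y₀ - y) = y by ring] at this
  have hgap : ∀ y ∈ Icc (u - ε) (v + ε), point i x₀ y ∈ P → y ∈ Icc u v := by
    intro y hy hyP
    constructor
    · by_contra! h
      refine hout₂ (y₀ - y) ⟨by linarith, by linarith [hy.1, min_le_right ε₁ ε₂]⟩ ?_
      rwa [show y₀ + -1 * (y₀ - y) = y by ring]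
    · by_contra! h
      refine hout₁ (y - y₀) ⟨by linarith, by linarith [hy.2, min_le_left ε₁ ε₂]⟩ ?_
      rwa [one_mul, add_sub_cancel]
  set R := {p : Plane | p i ∈ Icc x₁ x₂ ∧ p k ∈ Icc u v} with hRdef
  have hRP : R ⊆ P := by
    intro p hp
    have hf : Continuous fun x : ℝ => point i x (p k) :=
      (continuous_point hik).comp (by fun_prop : Continuous fun x : ℝ => (x, p k))
    have hcl : p i ∈ closure (Ioo x₁ x₂) := by rw [closure_Ioo hlt.ne]; exact hp.1
    have := map_mem_closure hf hcl (t := P) fun x hx => (hprod x hx _).2 (hin _ hp.2)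
    rwa [hP.isCompact.isClosed.closure_eq, point_eta hik] at this
  obtain ⟨N, hNc, hNi, hNR⟩ :=
    hP.exists_side hik hεpos (hy₀.1.trans hy₀.2) hRP (Ioo_subset_Icc_self hx₀m) hgap
  set O := {p : Plane | p i ∈ Ioo x₁ x₂ ∧ p k ∈ Ioo (u - ε) (v + ε)} with hO
  have hOopen : IsOpen O :=
    (isOpen_coord_preimage i isOpen_Ioo).inter (isOpen_coord_preimage k isOpen_Ioo)
  have hOR : ∀ p ∈ P, p ∈ O → p ∈ R := by
    intro p hp hpO
    refine ⟨Ioo_subset_Icc_self hpO.1, hgap _ (Ioo_subset_Icc_self hpO.2) ?_⟩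
    rw [← hprod _ hpO.1, point_eta hik]
    exact hp
  have hchord : ∀ p : Plane, p i = x₀ → p k ∈ Icc u v → p ∈ O := fun p h h' =>
    ⟨h ▸ hx₀m, by linarith [h'.1], by linarith [h'.2]⟩
  set f : Plane → ℝ := fun p => x₁ + (x₂ - x₁) * N p with hf
  have hfc : ContinuousOn f (P \ O) :=
    continuousOn_const.add (continuousOn_const.mul
      (hNc.mono fun p hp => ⟨hp.1, fun h => hp.2 (hchord p h.1 h.2)⟩))
  have hfR : ∀ p ∈ R, p ∉ O → f p = p i := by
    intro p hp hpO
    have hends : p i = x₁ ∨ p i = x₂ := by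
      by_contra! hne
      exact hpO ⟨⟨lt_of_le_of_ne hp.1.1 hne.1.symm, lt_of_le_of_ne hp.1.2 hne.2⟩,
        by linarith [hp.2.1], by linarith [hp.2.2]⟩
    have hN := hNR p hp.1 hp.2
    rcases hends with h | h
    · simp only [hf]; rw [hN.1 (by rw [h]; exact hx₀m.1), h]; ring
    · simp only [hf]; rw [hN.2 (by rw [h]; exact hx₀m.2), h]; ring
  have hRvis : R ⊆ visible P i k a b y₀ := fun p hp =>
    ⟨⟨ha.trans hp.1.1, hp.1.2.trans hb⟩, fun y hy => hRP
      ⟨by simpa using hp.1, by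
        rw [point_other hik]; exact (convex_Icc u v).ordConnected.uIcc_subset hp.2 hy₀ hy⟩⟩
  classical
  set g : Plane → ℝ := fun p => if p ∈ R then p i else f p with hg
  have hgf : ∀ p, p ∉ O → g p = f p := fun p hp => by
    simp only [hg]
    split_ifs with h
    · exact (hfR p h hp).symm
    · rfl
  have hRc : IsClosed R :=
    (isClosed_coord_preimage i isClosed_Icc).inter (isClosed_coord_preimage k isClosed_Icc)
  have hPO : IsCompact (P \ O) := hP.isCompact.diff hOopen
  -- off the chord, `N` is constant along a path from a visible point to the segment and along it
  have hNvis : ∀ x ∈ Icc a b, ∀ p ∈ visible P i k a b y₀, x₀ ∉ uIcc (p i) x →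
      N p = N (point i x y₀) := by
    intro x hx p hp hux
    have hpx : p i ≠ x₀ := fun h => hux (h ▸ left_mem_uIcc)
    have h1 : N p = N (point i (p i) y₀) := by
      refine eq_of_forall_exists_int (s := {q | q i ∈ ({p i} : Set ℝ) ∧ q k ∈ uIcc (p k) y₀})
        (isPreconnected_prod i k (convex_singleton _) (convex_uIcc _ _)) (hNc.mono ?_) ?_
        ⟨rfl, left_mem_uIcc⟩ ⟨by simp, by simp [point_other hik]⟩
      · rintro q ⟨hq₁, hq₂⟩
        have : q ∈ P := by
          rw [← point_of_eq hik hq₁ rfl]; exact hp.2 _ hq₂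
        exact ⟨this, fun h => hpx (hq₁.symm.trans h.1)⟩
      · rintro q ⟨hq₁, hq₂⟩
        refine hNi q ?_
        rw [← point_of_eq hik hq₁ rfl]; exact hp.2 _ hq₂
    have hsub : ∀ q : Plane, q i ∈ uIcc (p i) x ∧ q k ∈ ({y₀} : Set ℝ) → q ∈ P := by
      rintro q ⟨hq₁, hq₂⟩
      rw [← point_of_eq hik rfl hq₂]
      exact hs _ ((convex_Icc a b).ordConnected.uIcc_subset hp.1 hx hq₁)
    rw [h1]
    refine eq_of_forall_exists_int (s := {q | q i ∈ uIcc (p i) x ∧ q k ∈ ({y₀} : Set ℝ)})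
        (isPreconnected_prod i k (convex_uIcc _ _) (convex_singleton _)) (hNc.mono ?_) ?_
        ⟨by simp, by simp [point_other hik]⟩ ⟨by simp, by simp [point_other hik]⟩
    · exact fun q hq => ⟨hsub q hq, fun h => hux (h.1 ▸ hq.1)⟩
    · exact fun q hq => hNi q (hsub q hq)
  refine ⟨g, ?_, fun p hp => ?_, ?_⟩
  · have hunion : R ∪ P \ O = P := by
      ext p
      refine ⟨fun h => h.elim (fun h => hRP h) fun h => h.1, fun h => ?_⟩
      by_cases hpO : p ∈ O
      · exact Or.inl (hOR p h hpO)
      · exact Or.inr ⟨h, hpO⟩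
    rw [← hunion]
    refine ContinuousOn.union_of_isClosed ?_ ?_ hRc hPO.isClosed
    · exact (by fun_prop : Continuous fun p : Plane => p i).continuousOn.congr
        fun p hp => by simp only [hg]; rw [if_pos hp]
    · exact hfc.congr fun p hp => hgf p hp.2
  · by_cases hpR : p ∈ R
    · simp only [hg]
      rw [if_pos hpR, min_eq_right hpR.1.2, max_eq_right hpR.1.1]
    have hpP := visible_subset hik hp
    have hside : p i ≤ x₁ ∨ x₂ ≤ p i := by
      by_contra! hmid
      have hpk : p k ∈ Icc u v := by
        -- otherwise the line of sight of `p` meets a gap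
        have hvert : ∀ y ∈ uIcc (p k) y₀, point i x₀ y ∈ P := fun y hy =>
          (hprod _ hmid y).1 (hp.2 y hy)
        constructor
        · by_contra! h
          have h1 : max (p k) (u - ε) < u := max_lt h (by linarith)
          refine absurd (hgap (max (p k) (u - ε)) ⟨le_max_right _ _, by linarith [hy₀.1, hy₀.2]⟩
            (hvert _ ?_)).1 (not_le.2 h1)
          exact mem_uIcc.2 (Or.inl ⟨le_max_left _ _, by linarith [hy₀.1]⟩)
        · by_contra! h
          have h1 : v < min (p k) (v + ε) := lt_min h (by linarith)
          refine absurd (hgap (min (p k) (v + ε)) ⟨by linarith [hy₀.1, hy₀.2], min_le_right _ _⟩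
            (hvert _ ?_)).2 (not_le.2 h1)
          exact mem_uIcc.2 (Or.inr ⟨by linarith [hy₀.2], min_le_left _ _⟩)
      exact hpR ⟨⟨hmid.1.le, hmid.2.le⟩, hpk⟩
    simp only [hg]
    rw [if_neg hpR]
    rcases hside with h | h
    · have hN := hNvis x₁ ⟨ha, hlt.le.trans hb⟩ p hp
        (by rw [uIcc_of_le h]; exact fun hm => hm.2.not_gt hx₀m.1)
      have hN₁ := (hNR (point i x₁ y₀) (by simp [hlt.le]) (by simpa [point_other hik] using hy₀)).1
        (by simpa using hx₀m.1)
      simp only [hf]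
      rw [hN, hN₁, min_eq_right (h.trans hlt.le), max_eq_left h]; ring
    · have hN := hNvis x₂ ⟨ha.trans hlt.le, hb⟩ p hp
        (by rw [uIcc_of_ge h]; exact fun hm => hm.1.not_gt hx₀m.2)
      have hN₁ := (hNR (point i x₂ y₀) (by simp [hlt.le]) (by simpa [point_other hik] using hy₀)).2
        (by simpa using hx₀m.2)
      simp only [hf]
      rw [hN, hN₁, min_eq_left h, max_eq_right hlt.le]; ring
  · have hfin : (N '' (P \ O)).Finite := finite_image_of_forall_exists_int hPO
      (hNc.mono fun p hp => ⟨hp.1, fun h => hp.2 (hchord p h.1 h.2)⟩) fun p hp => hNi p hp.1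
    refine (hfin.image fun t => x₁ + (x₂ - x₁) * t).subset ?_
    rintro _ ⟨p, hp, rfl⟩
    have hpO : p ∉ O := fun h => hp.2 (hRvis (hOR p hp.1 h))
    exact ⟨N p, ⟨p, ⟨hp.1, hpO⟩, rfl⟩, (hgf p hpO).symm⟩

theorem IsTruncatedSweep.add {a b y₀ x₁ x₂ x₃ : ℝ} {g g' : Plane → ℝ}
    (h : IsTruncatedSweep P i k a b y₀ x₁ x₂ g) (h' : IsTruncatedSweep P i k a b y₀ x₂ x₃ g')
    (h₁₂ : x₁ ≤ x₂) (h₂₃ : x₂ ≤ x₃) :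
    IsTruncatedSweep P i k a b y₀ x₁ x₃ fun p => g p + g' p - x₂ := by
  refine ⟨(h.continuousOn.add h'.continuousOn).sub continuousOn_const, fun p hp => ?_, ?_⟩
  · rw [h.eq p hp, h'.eq p hp]
    rcases le_total (p i) x₂ with h1 | h1
    · rw [min_eq_right h1, min_eq_right (h1.trans h₂₃), max_eq_left h1]; ring
    · rw [min_eq_left h1, max_eq_right h₁₂, max_eq_right (le_min h₂₃ h1),
        max_eq_right (h₁₂.trans (le_min h₂₃ h1))]; ring
  · refine (Finite.image2 (fun s t => s + t - x₂) h.finite h'.finite).subset ?_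
    rintro _ ⟨p, hp, rfl⟩
    exact ⟨g p, ⟨p, hp, rfl⟩, g' p, ⟨p, hp, rfl⟩, rfl⟩

/-- Cutting at the grid lines reduces a general interval to strips. -/
theorem exists_isTruncatedSweep (hP : IsGridRegion P F) (hik : i ≠ k) {a b y₀ : ℝ}
    (hs : ∀ x ∈ Icc a b, point i x y₀ ∈ P) :
    ∀ n : ℕ, ∀ x₁ x₂, x₁ < x₂ → a ≤ x₁ → x₂ ≤ b → (F.filter (· ∈ Ioo x₁ x₂)).card = n →
      ∃ g, IsTruncatedSweep P i k a b y₀ x₁ x₂ g := by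
  intro n
  induction n using Nat.strong_induction_on with
  | _ n ih =>
    intro x₁ x₂ hlt ha hb hn
    by_cases hex : ∃ z ∈ F, z ∈ Ioo x₁ x₂
    · obtain ⟨z, hzF, hz⟩ := hex
      have hcard : ∀ s : Set ℝ, s ⊆ Ioo x₁ x₂ → z ∉ s → ∀ [DecidablePred (· ∈ s)],
          (F.filter (· ∈ s)).card < n := by
        intro s hss hzs _
        rw [← hn]
        refine Finset.card_lt_card ((Finset.ssubset_iff_of_subset fun y hy => ?_).2 ⟨z, ?_, ?_⟩)
        · simp only [Finset.mem_filter] at hy ⊢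
          exact ⟨hy.1, hss hy.2⟩
        · exact Finset.mem_filter.2 ⟨hzF, hz⟩
        · simp [hzs]
      obtain ⟨g, hg⟩ := ih _ (hcard (Ioo x₁ z) (Ioo_subset_Ioo_right hz.2.le) (by simp)) x₁ z hz.1
        ha (hz.2.le.trans hb) rfl
      obtain ⟨g', hg'⟩ := ih _ (hcard (Ioo z x₂) (Ioo_subset_Ioo_left hz.1.le) (by simp)) z x₂ hz.2
        (ha.trans hz.1.le) hb rfl
      exact ⟨_, hg.add hg' hz.1.le hz.2.le⟩
    · push Not at hex
      exact hP.exists_isTruncatedSweep_of_strip hik hs hlt ha hb hex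

end IsGridRegion

/-! ### Sweep coordinates of axis-parallel segments -/

namespace Plane

variable {i k : Fin 2}

theorem inner_eq (hik : i ≠ k) (p q : Plane) : inner ℝ p q = p i * q i + p k * q k := by
  simp only [PiLp.inner_apply, Fin.sum_univ_two, RCLike.inner_apply, conj_trivial]
  have : (i = 0 ∧ k = 1) ∨ (i = 1 ∧ k = 0) := by omega
  rcases this with ⟨rfl, rfl⟩ | ⟨rfl, rfl⟩ <;> ring

theorem sees_iff (hik : i ≠ k) {P s : Set Plane} {a b y₀ : ℝ} (hab : a < b)
    (hs : ∀ q, q ∈ s ↔ q k = y₀ ∧ q i ∈ Icc a b) {p q : Plane} :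
    Sees P s q p ↔ q = point i (p i) y₀ ∧ p ∈ visible P i k a b y₀ := by
  constructor
  · rintro ⟨hq, hseg, hperp⟩
    rw [hs] at hq
    have h := hperp (point i a y₀) ((hs _).2 (by simp [point_other hik, hab.le])) (point i b y₀)
      ((hs _).2 (by simp [point_other hik, hab.le]))
    rw [inner_eq hik] at h
    simp only [PiLp.sub_apply, point_same, point_other hik, sub_self, zero_mul, add_zero] at h
    have hpq : p i = q i :=
      sub_eq_zero.1 ((mul_eq_zero.1 h).resolve_left (_root_.sub_ne_zero.2 hab.ne'))
    refine ⟨(point_of_eq hik hpq.symm hq.1).symm, hpq ▸ hq.2, fun y hy => hseg ?_⟩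
    rw [mem_segment_iff hik hpq, hq.1]
    simpa [point_other hik] using hy
  · rintro ⟨rfl, hp, hvis⟩
    refine ⟨(hs _).2 (by simpa [point_other hik] using hp), fun z hz => ?_, fun x hx y hy => ?_⟩
    · rw [mem_segment_iff hik (by simp), point_other hik] at hz
      rw [← point_of_eq hik hz.1 rfl]
      exact hvis _ hz.2
    · rw [inner_eq hik]
      simp [((hs x).1 hx).1, ((hs y).1 hy).1]

end Plane

open Plane in
theorem IsGridRegion.nonempty_sweepCoordinate {P : Set Plane} {F : Finset ℝ}
    (hP : IsGridRegion P F) {s : Set Plane} (hs : IsAxisSegment s) (hsP : s ⊆ P) :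
    Nonempty (SweepCoordinate P s) := by
  obtain ⟨p, q, hpq, hax, rfl⟩ := hs
  obtain ⟨k, i, hik, hk⟩ : ∃ k i : Fin 2, i ≠ k ∧ p k = q k :=
    hax.elim (fun h => ⟨0, 1, by decide, h⟩) fun h => ⟨1, 0, by decide, h⟩
  set a := min (p i) (q i) with ha
  set b := max (p i) (q i) with hb
  set y₀ := p k with hy₀
  have hab : a < b := min_lt_max.2 fun h => hpq (eq_of_coord hik h hk)
  have hmem : ∀ z, z ∈ segment ℝ p q ↔ z k = y₀ ∧ z i ∈ Icc a b := fun z =>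
    mem_segment_iff hik.symm hk
  have hpt : ∀ x ∈ Icc a b, point i x y₀ ∈ segment ℝ p q := fun x hx =>
    (hmem _).2 (by simpa [point_other hik] using hx)
  obtain ⟨g, hg⟩ := hP.exists_isTruncatedSweep hik (fun x hx => hsP (hpt x hx)) _ a b hab le_rfl
    le_rfl rfl
  have hvis : slidingVisibility P (segment ℝ p q) = visible P i k a b y₀ := by
    ext z
    simp [slidingVisibility, sees_iff hik hab hmem]
  have hline : ∀ x : ℝ, point i 0 y₀ + x • EuclideanSpace.single i (1 : ℝ) = point i x y₀ :=
    fun x => eq_of_coord hik (by simp) (by simp [point_other hik, hik.symm])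
  exact ⟨{
    lo := a
    hi := b
    le := hab.le
    origin := point i 0 y₀
    dir := EuclideanSpace.single i 1
    norm_dir := by simp
    mem := fun x hx => by rw [hline]; exact hpt x hx
    surj := fun z hz => ⟨z i, ((hmem z).1 hz).2, by
      rw [hline]; exact point_of_eq hik rfl ((hmem z).1 hz).1⟩
    coord := fun z => max a (min b (g z))
    continuousOn_coord := continuousOn_const.sup (continuousOn_const.inf hg.continuousOn)
    coord_mem := fun z _ => ⟨le_max_left _ _, max_le hab.le (min_le_left _ _)⟩
    eq_of_sees := fun z w h => by
      obtain ⟨rfl, hw⟩ := (sees_iff hik hab hmem).1 h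
      have e : max a (min b (w i)) = w i := by rw [min_eq_right hw.1.2, max_eq_right hw.1.1]
      dsimp only
      rw [hg.eq w hw, e, e, hline]
    isClosed_visibility := by rw [hvis]; exact hP.isClosed_visible hik a b y₀
    finite_coord := by
      rw [hvis]
      refine (hg.finite.image fun t => max a (min b t)).subset ?_
      rintro _ ⟨z, hz, rfl⟩
      exact ⟨g z, ⟨z, hz, rfl⟩, rfl⟩ }⟩

theorem mainTheorem1 (P : Set Plane) (hP : IsSimpleOrthogonalPolygon P)
    (S : Finset (Set Plane)) (hS : ∀ s ∈ S, IsAxisSegment s ∧ s ⊆ P)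
    (hcover : (⋃ s ∈ S, slidingVisibility P s) = P)
    (c : ℝ) (hc : 0 < c) :
    ∃ M : MotionPlan S c, M.Clears P ∧ M.robots ≤ S.card := by
  obtain ⟨F, hF⟩ := hP.exists_isGridRegion
  set track : Fin S.card → Set Plane := fun i => S.equivFin.symm i with htrack
  have hmem : ∀ i, track i ∈ S := fun i => (S.equivFin.symm i).2
  have hR : ∀ i, Nonempty (SweepCoordinate P (track i)) := fun i =>
    hF.nonempty_sweepCoordinate (hS _ (hmem i)).1 (hS _ (hmem i)).2
  let R := fun i => (hR i).some
  obtain ⟨T, γ, hext, hclear⟩ := exists_extension_clearing hc R Finset.univ P Subset.rfl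
    (fun p hp => by
      rw [← hcover] at hp
      obtain ⟨s, hs, hps⟩ := mem_iUnion₂.1 hp
      exact ⟨S.equivFin ⟨s, hs⟩, Finset.mem_univ _, by simpa [htrack] using hps⟩)
    0 (fun i _ => (R i).origin + (R i).lo • (R i).dir) le_rfl fun i =>
      ⟨fun _ _ => (R i).mem _ ⟨le_rfl, (R i).le⟩, 0, fun _ => 0, fun _ => 0, rfl, rfl, by simp⟩
  refine ⟨⟨S.card, track, hmem, fun i j h => ?_, T, hext.le, γ, hext.motion⟩,
    fun e he heP => ?_, le_rfl⟩
  · exact S.equivFin.symm.injective (Subtype.ext h)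
  · by_contra! hn
    exact hclear e ⟨he, heP, hn⟩
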